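/- **Theorem 3.8 (Algorithm with a finite pair of opposite directions).** Let $D\subset\mathbb R^3$ be a bounded domain (nonempty, open, connected), let $0\le t_{\min}<t_{\max}$, and let $S(x,t)$ be a real-valued, jointly measurable source that vanishes outside $D\times[t_{\min},t_{\max}]$, belongs to $C([t_{\min},t_{\max}],L^\infty(D))$, and satisfies, for some constant $c_0>0$ and every $t\in[t_{\min},t_{\max}]$, $S(x,t)\ge c_0$ for a.e. $x\in D$. For $k\in\mathbb R$ and a unit vector $\hat x\in\mathbb S^2$ put $$f(y,k)=\frac1{\sqrt{2\pi}}\int_{\mathbb R}S(y,t)e^{ikt}\,dt,\qquad w^\infty(\hat x,k)=\int_D e^{-ik\hat x\cdot y}f(y,k)\,dy,$$ so that $w^\infty$ is the far-field pattern of the radiating solution of $\Delta w+k^2w=-f(\cdot,k)$ in $\mathbb R^3$. Let $0\le k_{\min}<k_{\max}$, $k_c=(k_{\min}+k_{\max})/2$, $K=(k_{\max}-k_{\min})/2$, and let $F^{(\hat x)}:L^2(0,K)\to L^2(0,K)$ be the far-field operator $$(F^{(\hat x)}\phi)(\tau)=\int_0^K w^\infty(\hat x,k_c+\tau-s)\,\phi(s)\,ds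 .$$ Put $F^{(\hat x)}_\#=|\mathrm{Re}\,F^{(\hat x)}|+|\mathrm{Im}\,F^{(\hat x)}|$, where $\mathrm{Re}\,F=\frac12(F+F^*)$, $\mathrm{Im}\,F=\frac1{2i}(F-F^*)$ and $|A|=(A^*A)^{1/2}$. Let $M\ge1$ and let $\hat x_1,\dots,\hat x_M$ be unit vectors. For each direction $\hat x\in\{\pm\hat x_j\}$ let $(\lambda_n^{(\hat x)},\psi_n^{(\hat x)})_{n\ge1}$ be an eigensystem of $F^{(\hat x)}_\#$, i.e. $(\psi_n^{(\hat x)})_n$ is a complete orthonormal system of $L^2(0,K)$ with $F^{(\hat x)}_\#\psi_n^{(\hat x)}=\lambda_n^{(\hat x)}\psi_n^{(\hat x)}$ and $\lambda_n^{(\hat x)}\in\mathbb R$. Consider either of the following two families of test functions on $(0,K)$: (a) ($t_{\min}$ known) $\displaystyle \phi^{(\hat x)}_{y,\eta}(k)=\frac1{\eta-t_{\min}}\int_{t_{\min}}^{\eta}e^{ik(t-\hat x\cdot y)}\,dt$ with $\eta\in(t_{\min},t_{\max}]$; (b) ($t_{\max}$ known) $\displaystyle \phi^{(\hat x)}_{y,\eta}(k)=\frac1{t_{\max}-\eta}\int_{\eta}^{t_{\max}}e^{ik(t-\hat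 x\cdot y)}\,dt$ with $\eta\in[t_{\min},t_{\max})$. For $y\in\mathbb R^3$ define, with values in $[0,\infty]$ and the conventions $1/\infty=0$, $1/0=\infty$, $$I^{(\hat x)}_{\eta}(y)=\sum_{n=1}^\infty\frac{\bigl|\langle\phi^{(\hat x)}_{y,\eta},\psi^{(\hat x)}_n\rangle_{L^2(0,K)}\bigr|^2}{|\lambda^{(\hat x)}_n|},\qquad W^{(\hat x)}(y)=\bigl[I^{(\hat x)}_{\eta}(y)+I^{(-\hat x)}_{\eta}(y)\bigr]^{-1},\qquad W(y)=\Bigl[\sum_{j=1}^M\frac1{W^{(\hat x_j)}(y)}\Bigr]^{-1}.$$ Let $K_D^{(\hat x)}=\{y\in\mathbb R^3:\inf_{z\in D}\hat x\cdot z<\hat x\cdot y<\sup_{z\in D}\hat x\cdot z\}$ and let $\Theta_D=\bigcap_{j=1}^M K_D^{(\hat x_j)}$ be the $\Theta$-convex hull of $D$. Then, in each of the cases (a) and (b) and for every admissible $\eta$: $0\le W(y)<\infty$ if $y\in\Theta_D$, and $W(y)=0$ if $y\notin\overline{\Theta_D}$. -/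

import Mathlib

open MeasureTheory Set Filter Topology
open scoped ENNReal ComplexStarModule

noncomputable section

namespace MultiFreq

/-- The physical space `ℝ³`. -/
abbrev E3 : Type := EuclideanSpace ℝ (Fin 3)

/-! ### Wave-number-dependent sources -/

/-- A time-dependent source `S(x,t)`: `D` is a bounded domain (nonempty, open, connected), the
source radiates during `[tmin, tmax]` with `0 ≤ tmin < tmax`, `S` is real-valued and belongs to
`C([tmin, tmax], L^∞(D))`, is extended by zero outside `D × [tmin, tmax]`, and is bounded below by
a positive constant on `D × [tmin, tmax]`. -/
structure Source where
  D : Set E3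
  isOpen_D : IsOpen D
  isConnected_D : IsConnected D
  isBounded_D : Bornology.IsBounded D
  tmin : ℝ
  tmax : ℝ
  tmin_nonneg : 0 ≤ tmin
  tmin_lt_tmax : tmin < tmax
  S : E3 → ℝ → ℝ
  measurable_S : Measurable (Function.uncurry S)
  eq_zero_of_notMem : ∀ y t, ¬ (y ∈ D ∧ t ∈ Icc tmin tmax) → S y t = 0
  memLp_S : ∀ t, MemLp (fun y => S y t) ∞ (volume.restrict D)
  continuousOn_S : ContinuousOn (fun t => (memLp_S t).toLp (fun y => S y t)) (Icc tmin tmax)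
  pos_S : ∃ c₀ : ℝ, 0 < c₀ ∧ ∀ t ∈ Icc tmin tmax, ∀ᵐ y ∂(volume.restrict D), c₀ ≤ S y t

namespace Source

variable (P : Source)

/-- The frequency-domain source `f(y,k) = (2π)^{-1/2} ∫_ℝ S(y,t) e^{ikt} dt`. -/
def freqSource (y : E3) (k : ℝ) : ℂ :=
  ((1 / Real.sqrt (2 * Real.pi) : ℝ) : ℂ) *
    ∫ t : ℝ, (P.S y t : ℂ) * Complex.exp (Complex.I * k * t)

/-- The far-field pattern `w^∞(x̂,k) = ∫_D e^{-ik x̂·y} f(y,k) dy`. -/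
def farField (x : E3) (k : ℝ) : ℂ :=
  ∫ y in P.D, Complex.exp (-Complex.I * k * (inner ℝ x y : ℝ)) * P.freqSource y k

/-- The radiating solution `w(x,k) = ∫ Φ(x-y;k) f(y,k) dy` of `Δw + k²w = -f(·,k)` in `ℝ³`, where
`Φ(z;k) = e^{ik|z|} / (4π|z|)`. -/
def radiatingSolution (x : E3) (k : ℝ) : ℂ :=
  ∫ y : E3, Complex.exp (Complex.I * k * ‖x - y‖) / (4 * Real.pi * ‖x - y‖) * P.freqSource y k

lemma exists_bound : ∃ C : ℝ, 0 ≤ C ∧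
    ∀ᵐ y ∂(volume.restrict P.D), ∀ᵐ t : ℝ, ‖P.S y t‖ ≤ (Icc P.tmin P.tmax).indicator (fun _ => C) t := by
  obtain ⟨C, hC⟩ := isCompact_Icc.exists_bound_of_continuousOn P.continuousOn_S
  have hC0 : 0 ≤ C := (norm_nonneg _).trans (hC P.tmin (left_mem_Icc.2 P.tmin_lt_tmax.le))
  refine ⟨C, hC0, ?_⟩
  have hmeas : MeasurableSet {z : E3 × ℝ |
      ‖P.S z.1 z.2‖ ≤ (Icc P.tmin P.tmax).indicator (fun _ => C) z.2} := by
    refine measurableSet_le (P.measurable_S.norm) ?_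
    exact (measurable_const.indicator measurableSet_Icc).comp measurable_snd
  rw [← Measure.ae_prod_iff_ae_ae (μ := volume.restrict P.D) (ν := (volume : Measure ℝ))
    (p := fun z => ‖P.S z.1 z.2‖ ≤ (Icc P.tmin P.tmax).indicator (fun _ => C) z.2) hmeas]
  have hmeas' : MeasurableSet {z : ℝ × E3 |
      ‖P.S z.2 z.1‖ ≤ (Icc P.tmin P.tmax).indicator (fun _ => C) z.1} := measurable_swap hmeas
  have h2 : ∀ᵐ z ∂((volume : Measure ℝ).prod (volume.restrict P.D)),
      ‖P.S z.2 z.1‖ ≤ (Icc P.tmin P.tmax).indicator (fun _ => C) z.1 := by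
    rw [Measure.ae_prod_iff_ae_ae hmeas']
    refine Eventually.of_forall fun t => ?_
    by_cases ht : t ∈ Icc P.tmin P.tmax
    · have h1 := hC t ht
      have h3 : ∀ᵐ y ∂(volume.restrict P.D), ‖((P.memLp_S t).toLp (fun y => P.S y t)) y‖ ≤ C := by
        filter_upwards [ae_le_eLpNormEssSup
          (f := ((P.memLp_S t).toLp (fun y => P.S y t) : E3 → ℝ)) (μ := volume.restrict P.D)]
          with y hy
        rw [Lp.norm_def, eLpNorm_exponent_top] at h1
        have hfin : eLpNormEssSup ((P.memLp_S t).toLp (fun y => P.S y t) : E3 → ℝ)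
            (volume.restrict P.D) ≠ ∞ := by
          rw [← eLpNorm_exponent_top]; exact (Lp.memLp _).2.ne
        refine le_trans ?_ h1
        rw [← toReal_enorm]
        exact ENNReal.toReal_mono hfin hy
      filter_upwards [h3, (P.memLp_S t).coeFn_toLp] with y hy hy'
      simp only [indicator_of_mem ht]
      rwa [← hy']
    · refine Eventually.of_forall fun y => ?_
      simp [P.eq_zero_of_notMem y t (fun h => ht h.2), indicator_of_notMem ht]
  exact (Measure.measurePreserving_swap (μ := volume.restrict P.D)
    (ν := (volume : Measure ℝ))).quasiMeasurePreserving.ae h2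

lemma norm_integrand_le {C : ℝ} {y : E3} (k : ℝ)
    (h : ∀ᵐ t : ℝ, ‖P.S y t‖ ≤ (Icc P.tmin P.tmax).indicator (fun _ => C) t) :
    ∀ᵐ t : ℝ, ‖(P.S y t : ℂ) * Complex.exp (Complex.I * k * t)‖ ≤
      (Icc P.tmin P.tmax).indicator (fun _ => C) t := by
  filter_upwards [h] with t ht
  have : Complex.I * k * t = ((k * t : ℝ) : ℂ) * Complex.I := by push_cast; ring
  rw [norm_mul, this, Complex.norm_exp_ofReal_mul_I, mul_one, Complex.norm_real]
  exact ht

lemma integrable_ind (C : ℝ) :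
    Integrable ((Icc P.tmin P.tmax).indicator (fun _ => C)) (volume : Measure ℝ) := by
  rw [integrable_indicator_iff measurableSet_Icc]
  exact integrableOn_const (by simp)

lemma measurable_freqSource (k : ℝ) : StronglyMeasurable (fun y => P.freqSource y k) := by
  have h : StronglyMeasurable (Function.uncurry fun (y : E3) (t : ℝ) =>
      (P.S y t : ℂ) * Complex.exp (Complex.I * k * t)) := by
    apply Measurable.stronglyMeasurable
    have h1 : Measurable fun z : E3 × ℝ => ((P.S z.1 z.2 : ℝ) : ℂ) :=
      Complex.measurable_ofReal.comp P.measurable_S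
    have h2 : Measurable fun z : E3 × ℝ => Complex.exp (Complex.I * k * (z.2 : ℂ)) := by
      fun_prop
    exact h1.mul h2
  exact (h.integral_prod_right (ν := (volume : Measure ℝ))).const_mul _

lemma exists_bound_freqSource : ∃ C : ℝ, ∀ᵐ y ∂(volume.restrict P.D),
    (∀ k, ‖P.freqSource y k‖ ≤ C) ∧ Continuous fun k => P.freqSource y k := by
  obtain ⟨C, -, hC⟩ := P.exists_bound
  refine ⟨‖((1 / Real.sqrt (2 * Real.pi) : ℝ) : ℂ)‖ *
    ∫ t : ℝ, (Icc P.tmin P.tmax).indicator (fun _ => C) t, ?_⟩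
  filter_upwards [hC] with y hy
  refine ⟨fun k => ?_, ?_⟩
  · rw [freqSource, norm_mul]
    exact mul_le_mul_of_nonneg_left
      (norm_integral_le_of_norm_le (P.integrable_ind C) (P.norm_integrand_le k hy)) (norm_nonneg _)
  · refine continuous_const.mul
      (continuous_of_dominated (bound := (Icc P.tmin P.tmax).indicator (fun _ => C))
        (fun k => ?_) (fun k => P.norm_integrand_le k hy) (P.integrable_ind C) ?_)
    · have h1 : Measurable fun t : ℝ => ((P.S y t : ℝ) : ℂ) :=
        Complex.measurable_ofReal.comp (P.measurable_S.comp measurable_prodMk_left)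
      have h2 : Measurable fun t : ℝ => Complex.exp (Complex.I * k * (t : ℂ)) := by fun_prop
      exact (h1.mul h2).aestronglyMeasurable
    · exact Eventually.of_forall fun t => by fun_prop

lemma norm_phase (a : ℝ) (k : ℝ) : ‖Complex.exp (-Complex.I * k * (a : ℂ))‖ = 1 := by
  have : -Complex.I * k * (a : ℂ) = ((-(k * a) : ℝ) : ℂ) * Complex.I := by push_cast; ring
  rw [this, Complex.norm_exp_ofReal_mul_I]

lemma continuous_farField (x : E3) : Continuous (P.farField x) := by
  obtain ⟨C, hC⟩ := P.exists_bound_freqSource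
  have hfin : volume P.D ≠ ∞ := P.isBounded_D.measure_lt_top.ne
  refine continuous_of_dominated (bound := fun _ => C) (fun k => ?_) (fun k => ?_) ?_ ?_
  · have h2 : Measurable fun y : E3 =>
        Complex.exp (-Complex.I * k * ((inner ℝ x y : ℝ) : ℂ)) := by fun_prop
    exact (h2.stronglyMeasurable.mul (P.measurable_freqSource k)).aestronglyMeasurable
  · filter_upwards [hC] with y hy
    rw [norm_mul, norm_phase, one_mul]
    exact hy.1 k
  · exact integrableOn_const hfin
  · filter_upwards [hC] with y hy
    exact Continuous.mul (by fun_prop) hy.2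

lemma freqSource_eq_zero {y : E3} (hy : y ∉ P.D) (k : ℝ) : P.freqSource y k = 0 := by
  simp [freqSource, P.eq_zero_of_notMem y _ (fun h => hy h.1)]

lemma tendsto_norm_sub (x y : E3) (hx : ‖x‖ = 1) :
    Tendsto (fun r : ℝ => ‖r • x - y‖ / r) atTop (𝓝 1) ∧
    Tendsto (fun r : ℝ => ‖r • x - y‖ - r) atTop (𝓝 (-(inner ℝ x y : ℝ))) := by
  have hn : ∀ r : ℝ, 0 < r → ‖r • x‖ = r := fun r hr => by
    rw [norm_smul, hx, mul_one, Real.norm_of_nonneg hr.le]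
  have h0 : Tendsto (fun r : ℝ => ‖y‖ / r) atTop (𝓝 0) := tendsto_const_nhds.div_atTop tendsto_id
  have h1 : Tendsto (fun r : ℝ => ‖r • x - y‖ / r) atTop (𝓝 1) := by
    rw [tendsto_iff_norm_sub_tendsto_zero]
    refine squeeze_zero' (Eventually.of_forall fun _ => norm_nonneg _) ?_ h0
    filter_upwards [eventually_gt_atTop 0] with r hr
    have h := abs_norm_sub_norm_le (r • x - y) (r • x)
    rw [hn r hr, sub_sub_cancel_left, norm_neg] at h
    have h2 : ‖r • x - y‖ / r - 1 = (‖r • x - y‖ - r) / r := by field_simp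
    rw [h2, Real.norm_eq_abs, abs_div, abs_of_pos hr]
    gcongr
  refine ⟨h1, ?_⟩
  have h2 : Tendsto (fun r : ℝ => (-2 * (inner ℝ x y : ℝ) + ‖y‖ ^ 2 / r) / (‖r • x - y‖ / r + 1))
      atTop (𝓝 ((-2 * (inner ℝ x y : ℝ) + 0) / (1 + 1))) :=
    (tendsto_const_nhds.add (tendsto_const_nhds.div_atTop tendsto_id)).div
      (h1.add tendsto_const_nhds) (by norm_num)
  have h3 : (-2 * (inner ℝ x y : ℝ) + 0) / (1 + 1) = -(inner ℝ x y : ℝ) := by ring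
  rw [h3] at h2
  refine h2.congr' ?_
  filter_upwards [eventually_gt_atTop 0] with r hr
  have hsq : ‖r • x - y‖ ^ 2 = r ^ 2 - 2 * (r * (inner ℝ x y : ℝ)) + ‖y‖ ^ 2 := by
    rw [norm_sub_sq_real, hn r hr, real_inner_smul_left]
  have hpos : 0 < ‖r • x - y‖ + r := add_pos_of_nonneg_of_pos (norm_nonneg _) hr
  have h4 : ‖r • x - y‖ / r + 1 = (‖r • x - y‖ + r) / r := by field_simp
  rw [h4, div_eq_iff (by positivity)]
  field_simp
  linear_combination (-1 : ℝ) * hsq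

/-- `farField` is indeed the far-field pattern of the radiating solution, that is
`w(r x̂,k) = e^{ikr} / (4πr) (w^∞(x̂,k) + o(1))` as `r → ∞`. -/
lemma tendsto_farField (x : E3) (hx : ‖x‖ = 1) (k : ℝ) :
    Tendsto (fun r : ℝ => 4 * Real.pi * r * Complex.exp (-Complex.I * k * r) *
      P.radiatingSolution (r • x) k) atTop (𝓝 (P.farField x k)) := by
  obtain ⟨C, hC⟩ := P.exists_bound_freqSource
  obtain ⟨R, hR0, hR⟩ := P.isBounded_D.exists_pos_norm_le
  have hfin : volume P.D ≠ ∞ := P.isBounded_D.measure_lt_top.ne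
  have hD := P.isOpen_D.measurableSet
  have hrew : ∀ r : ℝ, 4 * Real.pi * r * Complex.exp (-Complex.I * k * r) *
      P.radiatingSolution (r • x) k = ∫ y in P.D, 4 * Real.pi * r *
        Complex.exp (-Complex.I * k * r) * (Complex.exp (Complex.I * k * ‖r • x - y‖) /
          (4 * Real.pi * ‖r • x - y‖) * P.freqSource y k) := by
    intro r
    rw [integral_const_mul, radiatingSolution, setIntegral_eq_integral_of_forall_compl_eq_zero]
    intro y hy
    rw [P.freqSource_eq_zero hy, mul_zero]
  have hform : ∀ (r : ℝ) (y : E3), 4 * Real.pi * r *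
        Complex.exp (-Complex.I * k * r) * (Complex.exp (Complex.I * k * ‖r • x - y‖) /
          (4 * Real.pi * ‖r • x - y‖) * P.freqSource y k) =
      (((‖r • x - y‖ / r)⁻¹ : ℝ) : ℂ) *
        Complex.exp (-Complex.I * k * ((-(‖r • x - y‖ - r) : ℝ) : ℂ)) * P.freqSource y k := by
    intro r y
    have hpi : (Real.pi : ℂ) ≠ 0 := by exact_mod_cast Real.pi_ne_zero
    have he : Complex.exp (-Complex.I * k * ((-(‖r • x - y‖ - r) : ℝ) : ℂ)) =
        Complex.exp (-Complex.I * k * r) * Complex.exp (Complex.I * k * ‖r • x - y‖) := by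
      rw [← Complex.exp_add]; congr 1; push_cast; ring
    rw [he, inv_div, mul_comm (4 * (Real.pi : ℂ)) ((‖r • x - y‖ : ℝ) : ℂ)]
    push_cast
    rcases eq_or_ne ((‖r • x - y‖ : ℝ) : ℂ) 0 with h0 | h0
    · simp [h0]
    · field_simp
  simp_rw [hrew, hform]
  refine tendsto_integral_filter_of_dominated_convergence (fun _ => 2 * C) ?_ ?_ ?_ ?_
  · refine Eventually.of_forall fun r => ?_
    have h2 : Measurable fun y : E3 => (((‖r • x - y‖ / r)⁻¹ : ℝ) : ℂ) *
        Complex.exp (-Complex.I * k * ((-(‖r • x - y‖ - r) : ℝ) : ℂ)) := by fun_prop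
    exact (h2.stronglyMeasurable.mul (P.measurable_freqSource k)).aestronglyMeasurable
  · filter_upwards [eventually_gt_atTop (2 * R)] with r hr
    filter_upwards [hC, ae_restrict_mem hD] with y hy hyD
    have hr0 : 0 < r := by linarith
    rw [norm_mul, norm_mul, norm_phase, mul_one, Complex.norm_real, inv_div]
    have h1 : r / 2 ≤ ‖r • x - y‖ := by
      have h := norm_sub_norm_le (r • x) y
      rw [norm_smul, hx, mul_one, Real.norm_of_nonneg hr0.le] at h
      linarith [hR y hyD]
    have h2 : ‖r / ‖r • x - y‖‖ ≤ 2 := by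
      rw [Real.norm_of_nonneg (by positivity), div_le_iff₀ (by linarith)]
      linarith
    exact mul_le_mul h2 (hy.1 k) (norm_nonneg _) (by norm_num)
  · exact integrableOn_const hfin
  · refine Eventually.of_forall fun y => ?_
    obtain ⟨h1, h2⟩ := tendsto_norm_sub x y hx
    have h3 := (Complex.continuous_ofReal.tendsto _).comp (h1.inv₀ one_ne_zero)
    have h4 : Tendsto (fun r : ℝ =>
        Complex.exp (-Complex.I * k * ((-(‖r • x - y‖ - r) : ℝ) : ℂ))) atTop
        (𝓝 (Complex.exp (-Complex.I * k * ((- -(inner ℝ x y : ℝ) : ℝ) : ℂ)))) := by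
      have hc : Continuous fun u : ℝ => Complex.exp (-Complex.I * k * ((-u : ℝ) : ℂ)) := by
        fun_prop
      exact (hc.tendsto _).comp h2
    have h5 := (h3.mul h4).mul_const (P.freqSource y k)
    simpa using h5

end Source

/-! ### The multi-frequency far-field operator -/

/-- The Hilbert space `L²(0,K)` of complex-valued functions. -/
abbrev L2 (K : ℝ) : Type := Lp ℂ 2 (volume.restrict (Ioo (0 : ℝ) K))

lemma exists_norm_integral_le {κ : ℝ → ℂ} (hκ : Continuous κ) (K : ℝ) :
    ∃ C : ℝ, 0 ≤ C ∧ ∀ φ : L2 K, ∀ τ ∈ Ioo (0 : ℝ) K,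
      Integrable (fun s => κ (τ - s) * φ s) (volume.restrict (Ioo (0 : ℝ) K)) ∧
      ‖∫ s in Ioo (0 : ℝ) K, κ (τ - s) * φ s‖ ≤ C * ‖φ‖ := by
  obtain ⟨M, hM⟩ := (isCompact_Icc (a := -K) (b := K)).exists_bound_of_continuousOn hκ.continuousOn
  set μ := volume.restrict (Ioo (0 : ℝ) K) with hμ
  set A : ℝ := (μ univ ^ (1 / (1 : ℝ≥0∞).toReal - 1 / (2 : ℝ≥0∞).toReal)).toReal with hA
  refine ⟨|M| * A, by positivity, fun φ τ hτ => ?_⟩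
  have hφ : Integrable φ μ := memLp_one_iff_integrable.1 ((Lp.memLp φ).mono_exponent (by norm_num))
  have hbd : ∀ᵐ s ∂μ, ‖κ (τ - s)‖ ≤ |M| := by
    filter_upwards [ae_restrict_mem measurableSet_Ioo] with s hs
    exact (hM (τ - s) ⟨by linarith [hτ.1, hs.2], by linarith [hτ.2, hs.1]⟩).trans (le_abs_self M)
  have hint : Integrable (fun s => κ (τ - s) * φ s) μ :=
    hφ.bdd_mul (c := |M|) (by fun_prop) hbd
  refine ⟨hint, ?_⟩
  have h1 : ‖∫ s, κ (τ - s) * φ s ∂μ‖ ≤ ∫ s, |M| * ‖φ s‖ ∂μ := by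
    refine norm_integral_le_of_norm_le (hφ.norm.const_mul _) ?_
    filter_upwards [hbd] with s hs
    rw [norm_mul]
    exact mul_le_mul_of_nonneg_right hs (norm_nonneg _)
  have h2 : ∫ s, ‖φ s‖ ∂μ ≤ A * ‖φ‖ := by
    have h3 := eLpNorm_le_eLpNorm_mul_rpow_measure_univ (μ := μ) (p := 1) (q := 2) (by norm_num)
      (Lp.aestronglyMeasurable φ)
    rw [integral_norm_eq_lintegral_enorm (Lp.aestronglyMeasurable φ), ← eLpNorm_one_eq_lintegral_enorm,
      Lp.norm_def, mul_comm, hA, ← ENNReal.toReal_mul]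
    refine ENNReal.toReal_mono (ENNReal.mul_ne_top (Lp.memLp φ).2.ne ?_) h3
    exact ENNReal.rpow_ne_top_of_nonneg (by norm_num) (measure_ne_top _ _)
  calc ‖∫ s, κ (τ - s) * φ s ∂μ‖ ≤ |M| * ∫ s, ‖φ s‖ ∂μ := by
        rwa [integral_const_mul] at h1
    _ ≤ |M| * (A * ‖φ‖) := by gcongr
    _ = |M| * A * ‖φ‖ := by ring

lemma memLp_conv {κ : ℝ → ℂ} (hκ : Continuous κ) (K : ℝ) (φ : L2 K) :
    MemLp (fun τ => ∫ s in Ioo (0 : ℝ) K, κ (τ - s) * φ s) 2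
      (volume.restrict (Ioo (0 : ℝ) K)) := by
  obtain ⟨C, -, hC⟩ := exists_norm_integral_le hκ K
  refine MemLp.of_bound ?_ (C * ‖φ‖) ?_
  · have h : StronglyMeasurable (Function.uncurry fun τ s : ℝ => κ (τ - s) * φ s) :=
      (hκ.comp (continuous_fst.sub continuous_snd)).stronglyMeasurable.mul
        ((Lp.stronglyMeasurable φ).comp_measurable measurable_snd)
    exact h.integral_prod_right.aestronglyMeasurable
  · filter_upwards [ae_restrict_mem measurableSet_Ioo] with τ hτ
    exact (hC φ τ hτ).2

/-- The bounded operator `(A φ)(τ) = ∫_0^K κ(τ - s) φ(s) ds` on `L²(0,K)`, for a continuous `κ`. -/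
def convOp (κ : ℝ → ℂ) (hκ : Continuous κ) (K : ℝ) : L2 K →L[ℂ] L2 K :=
  LinearMap.mkContinuousOfExistsBound
    { toFun := fun φ => (memLp_conv hκ K φ).toLp (fun τ => ∫ s in Ioo (0 : ℝ) K, κ (τ - s) * φ s)
      map_add' := by
        intro φ χ
        obtain ⟨C, -, hC⟩ := exists_norm_integral_le hκ K
        rw [← MemLp.toLp_add, MemLp.toLp_eq_toLp_iff]
        filter_upwards [ae_restrict_mem measurableSet_Ioo] with τ hτ
        rw [Pi.add_apply, ← integral_add (hC φ τ hτ).1 (hC χ τ hτ).1]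
        refine integral_congr_ae ?_
        filter_upwards [Lp.coeFn_add φ χ] with s hs
        rw [hs, Pi.add_apply, mul_add]
      map_smul' := by
        intro c φ
        rw [RingHom.id_apply, ← MemLp.toLp_const_smul, MemLp.toLp_eq_toLp_iff]
        refine Eventually.of_forall fun τ => ?_
        simp only [Pi.smul_apply]
        rw [← integral_smul]
        refine integral_congr_ae ?_
        filter_upwards [Lp.coeFn_smul c φ] with s hs
        rw [hs, Pi.smul_apply, smul_eq_mul, smul_eq_mul, mul_left_comm] }
    (by
      obtain ⟨C, hC0, hC⟩ := exists_norm_integral_le hκ K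
      refine ⟨(measureUnivNNReal (volume.restrict (Ioo (0 : ℝ) K)) : ℝ) ^ (2 : ℝ≥0∞).toReal⁻¹ * C,
        fun φ => ?_⟩
      rw [mul_assoc]
      refine Lp.norm_le_of_ae_bound (by positivity) ?_
      filter_upwards [(memLp_conv hκ K φ).coeFn_toLp, ae_restrict_mem measurableSet_Ioo]
        with τ h1 hτ
      refine le_trans (le_of_eq ?_) (hC φ τ hτ).2
      exact congrArg norm h1)

/-- The far-field operator
`(F φ)(τ) = ∫_0^K w^∞(x̂, k_c + τ - s) φ(s) ds` on `L²(0,K)`, where `k_c = (kmin + kmax)/2` and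
`K = (kmax - kmin)/2`; it only involves wave numbers in `[kmin, kmax]`. -/
def farFieldOp (P : Source) (kmin kmax : ℝ) (x : E3) :
    L2 ((kmax - kmin) / 2) →L[ℂ] L2 ((kmax - kmin) / 2) :=
  convOp (fun u => P.farField x ((kmin + kmax) / 2 + u))
    ((P.continuous_farField x).comp (continuous_const.add continuous_id)) ((kmax - kmin) / 2)

/-- `F_# = |Re F| + |Im F|` with `Re F = (F + F^*)/2`, `Im F = (F - F^*)/(2i)` and
`|A| = (A^* A)^{1/2}`. -/
def sharp {H : Type*} [NormedAddCommGroup H] [InnerProductSpace ℂ H] [CompleteSpace H]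
    (F : H →L[ℂ] H) : H →L[ℂ] H :=
  CFC.abs (realPart F : H →L[ℂ] H) + CFC.abs (imaginaryPart F : H →L[ℂ] H)

/-- `(lam n, ψ n)` is an eigensystem of `T`: the `ψ n` form a complete orthonormal system of
eigenvectors of `T` with eigenvalues `lam n`. -/
structure IsEigensystem {H : Type*} [NormedAddCommGroup H] [InnerProductSpace ℂ H]
    (T : H →L[ℂ] H) (lam : ℕ → ℝ) (ψ : ℕ → H) : Prop where
  orthonormal : Orthonormal ℂ ψ
  complete : (Submodule.span ℂ (range ψ)).topologicalClosure = ⊤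
  eigen : ∀ n, T (ψ n) = (lam n : ℂ) • ψ n

/-! ### Test functions and indicator functions -/

/-- The test function `k ↦ (b - a)^{-1} (∫_a^b e^{ikt} dt) e^{-ik x̂·y}`. -/
def testFun (a b : ℝ) (x y : E3) (k : ℝ) : ℂ :=
  ((1 / (b - a) : ℝ) : ℂ) * (∫ t in a..b, Complex.exp (Complex.I * k * t)) *
    Complex.exp (-Complex.I * k * (inner ℝ x y : ℝ))

lemma memLp_testFun (a b : ℝ) (x y : E3) (K : ℝ) :
    MemLp (testFun a b x y) 2 (volume.restrict (Ioo (0 : ℝ) K)) := by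
  have h0 : Continuous fun k : ℝ => ∫ t in a..b, Complex.exp (Complex.I * k * t) := by
    apply intervalIntegral.continuous_parametric_intervalIntegral_of_continuous'
    simp only [Function.uncurry_def]
    fun_prop
  have h : Continuous (testFun a b x y) := by
    unfold testFun
    fun_prop
  obtain ⟨C, hC⟩ := (isCompact_Icc (a := 0) (b := K)).exists_bound_of_continuousOn h.continuousOn
  refine MemLp.of_bound h.aestronglyMeasurable C ?_
  filter_upwards [ae_restrict_mem measurableSet_Ioo] with k hk
  exact hC k (Ioo_subset_Icc_self hk)

/-- The test function as an element of `L²(0,K)`. -/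
def testVec (a b : ℝ) (x y : E3) (K : ℝ) : L2 K := (memLp_testFun a b x y K).toLp _

/-- The series `∑_n |⟨φ, ψ_n⟩|² / |λ_n|`, with values in `[0,∞]`. -/
def picardSum {H : Type*} [NormedAddCommGroup H] [InnerProductSpace ℂ H]
    (lam : ℕ → ℝ) (ψ : ℕ → H) (φ : H) : ℝ≥0∞ :=
  ∑' n, ENNReal.ofReal (‖(inner ℂ (ψ n) φ : ℂ)‖ ^ 2) / ENNReal.ofReal |lam n|

/-- The indicator function `W^{(x̂)}(y) = [I^{(x̂)}(y) + I^{(-x̂)}(y)]^{-1}` for the pair of opposite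
directions `±x̂`, with the conventions `1/∞ = 0` and `1/0 = ∞`. -/
def indicatorPair {K : ℝ} (lam : E3 → ℕ → ℝ) (ψ : E3 → ℕ → L2 K) (a b : ℝ) (x y : E3) : ℝ≥0∞ :=
  (picardSum (lam x) (ψ x) (testVec a b x y K) +
    picardSum (lam (-x)) (ψ (-x)) (testVec a b (-x) y K))⁻¹

/-- The indicator function `W(y) = [∑_j 1 / W^{(x̂_j)}(y)]^{-1}`. -/
def indicatorW {K : ℝ} {M : ℕ} (lam : E3 → ℕ → ℝ) (ψ : E3 → ℕ → L2 K) (a b : ℝ)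
    (x : Fin M → E3) (y : E3) : ℝ≥0∞ :=
  (∑ j, 1 / indicatorPair lam ψ a b (x j) y)⁻¹

/-! ### Strips and the `Θ`-convex hull -/

/-- The strip `K_D^{(x̂)} = {y : inf (x̂·D) < x̂·y < sup (x̂·D)}`. -/
def strip (D : Set E3) (x : E3) : Set E3 :=
  {y | sInf ((fun z => (inner ℝ x z : ℝ)) '' D) < inner ℝ x y ∧
    inner ℝ x y < sSup ((fun z => (inner ℝ x z : ℝ)) '' D)}

/-- The `Θ`-convex hull `Θ_D = ⋂_j K_D^{(x̂_j)}`. -/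
def thetaHull (D : Set E3) {M : ℕ} (x : Fin M → E3) : Set E3 := ⋂ j, strip D (x j)

end MultiFreq

end

/-! `W` is finite because each test function is nonzero in `L²(0,K)` and the eigenvectors are
complete, so no Picard sum vanishes. For `W = 0` a single divergent Picard sum suffices.

The far-field pattern is the Fourier transform of a positive measure `ν`, the law of `t - x̂·y`,
carried by `[α,β] = [tmin - sup x̂·D, tmax - inf x̂·D]`. With `L^*` the finite Fourier transform
into `L²(ν)`, the operators Re F and Im F have the form `L c L^*`, where `c` is the cosine or the
sine of `k_c ξ`. A finite Picard sum puts the test function in Range |Re F|^{1/2} + Range |Im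
F|^{1/2}. Elements of these ranges extend to entire functions which at `z = is` are at most a
polynomial in `|s|` times max(e^{-sα}, e^{-sβ}) (`exists_entire_extension`). The test function is an
average of e^{iz(t-p)}, `p = x̂·y`, `t ∈ [a,b]`, and violates this bound once `[a-p,b-p]` sticks out
of `[α,β]` (`picardSum_eq_top`). With `a = tmin` this happens for `x̂·y > sup x̂·D`, with `b = tmax`
for `x̂·y < inf x̂·D`; the direction `-x̂` covers the other side of the strip.

The extension is the hard point, since `c` changes sign. Spectral cutting writes |A|^{1/2}u = Σ A
h_j with ‖h_j‖ ≲ 2^j and ‖A h_j‖ ≲ 2^{-j} (`exists_hasSum_sqrtAbs`). Each A h_j is an exponential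
integral with density c ĥ_j, but the obvious bound on that density is 2^j. Two facts repair this.
Smallness on (0,K) spreads by the three lines theorem, giving (3/4)^j e^{B(1+|z|)^4} on all of ℂ and
2^{-j} poly(j) for the derivatives on [0,K] (`exists_bound_of_small_primitive`). And a polynomial
`q` with c² ≤ q c gives ∫|c ĥ_j|² dν ≤ ⟨h_j, q(-i d/ds) A h_j⟩, where 2^j and 2^{-j} cancel, so the
density is only polynomially large in `j` (`integral_norm_le_of_polynomial`). The second bound
serves `j ≲ (1+|s|)^4`, the first all later `j`. -/

noncomputable section

namespace MultiFreq

/-! ### Polynomials with the sign changes of a sine -/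

/-- Euler's product splits the sine as p·r, where the partial product p carries all sign changes on
[-R,R] and the tail r lies in [0,1] there. Hence sin² = p²r² ≤ p²r = p·sin, and `q` is p. -/
lemma exists_polynomial_sin_sq_le (R : ℝ) : ∃ q : Polynomial ℝ, ∀ x : ℝ, |x| ≤ R →
    Real.sin x ^ 2 ≤ q.eval x * Real.sin x := by
  obtain ⟨n, hn⟩ := exists_nat_ge (R / Real.pi)
  let p : ℕ → ℝ → ℝ := fun m y =>
    Real.pi * y * ∏ j ∈ Finset.range m, ((1 : ℝ) - y ^ 2 / ((j : ℝ) + 1) ^ 2)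
  let q₀ : Polynomial ℝ := Polynomial.C Real.pi * Polynomial.X *
    ∏ j ∈ Finset.range n, (1 - Polynomial.X ^ 2 * Polynomial.C ((((j : ℝ) + 1) ^ 2)⁻¹))
  have hq₀ : ∀ y, q₀.eval y = p n y := fun y => by
    simp only [q₀, p, Polynomial.eval_mul, Polynomial.eval_prod, Polynomial.eval_sub,
      Polynomial.eval_one, Polynomial.eval_pow, Polynomial.eval_X, Polynomial.eval_C,
      div_eq_mul_inv]
  have key : ∀ y : ℝ, |y| ≤ n → Real.sin (Real.pi * y) ^ 2 ≤ p n y * Real.sin (Real.pi * y) := by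
    intro y hy
    have ht := Real.tendsto_euler_sin_prod y
    refine le_of_tendsto_of_tendsto (ht.pow 2) (ht.const_mul (p n y)) ?_
    filter_upwards [eventually_ge_atTop n] with m hm
    set r : ℝ := ∏ j ∈ Finset.Ico n m, ((1 : ℝ) - y ^ 2 / ((j : ℝ) + 1) ^ 2)
    have hfac : ∀ j ∈ Finset.Ico n m, 0 ≤ (1 : ℝ) - y ^ 2 / ((j : ℝ) + 1) ^ 2 ∧
        (1 : ℝ) - y ^ 2 / ((j : ℝ) + 1) ^ 2 ≤ 1 := by
      intro j hj
      have h1 : (n : ℝ) ≤ j := by exact_mod_cast (Finset.mem_Ico.1 hj).1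
      have h2 : y ^ 2 ≤ ((j : ℝ) + 1) ^ 2 := by
        rw [sq_le_sq, abs_of_nonneg (by positivity : (0 : ℝ) ≤ (j : ℝ) + 1)]; linarith
      refine ⟨sub_nonneg.2 (div_le_one_of_le₀ h2 (by positivity)), ?_⟩
      have : 0 ≤ y ^ 2 / ((j : ℝ) + 1) ^ 2 := by positivity
      linarith
    have hr0 : 0 ≤ r := Finset.prod_nonneg fun j hj => (hfac j hj).1
    have hr1 : r ≤ 1 := Finset.prod_le_one (fun j hj => (hfac j hj).1) fun j hj => (hfac j hj).2
    have hpm : Real.pi * y * ∏ j ∈ Finset.range m, ((1 : ℝ) - y ^ 2 / ((j : ℝ) + 1) ^ 2)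
        = p n y * r := by
      rw [← Finset.prod_range_mul_prod_Ico _ hm, ← mul_assoc]
    rw [hpm]
    have : 0 ≤ p n y ^ 2 * (r * (1 - r)) :=
      mul_nonneg (sq_nonneg _) (mul_nonneg hr0 (sub_nonneg.2 hr1))
    nlinarith
  refine ⟨q₀.comp (Polynomial.C Real.pi⁻¹ * Polynomial.X), fun x hx => ?_⟩
  have h := key (Real.pi⁻¹ * x) (by
    rw [abs_mul, abs_of_pos (inv_pos.2 Real.pi_pos), inv_mul_eq_div]
    exact le_trans (by gcongr) hn)
  rw [mul_inv_cancel_left₀ Real.pi_ne_zero] at h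
  simpa [Polynomial.eval_comp, hq₀] using h

/-- The phase `θ` lets one statement serve the sine (`θ = 0`) and the cosine (`θ = π/2`). -/
lemma exists_polynomial_sin_affine_sq_le (k θ a : ℝ) : ∃ q : Polynomial ℝ, ∀ ξ : ℝ, |ξ| ≤ a →
    Real.sin (k * ξ + θ) ^ 2 ≤ q.eval ξ * Real.sin (k * ξ + θ) := by
  obtain ⟨q, hq⟩ := exists_polynomial_sin_sq_le (|k| * a + |θ|)
  refine ⟨q.comp (Polynomial.C k * Polynomial.X + Polynomial.C θ), fun ξ hξ => ?_⟩
  have := hq (k * ξ + θ) ((abs_add_le _ _).trans (by rw [abs_mul]; gcongr))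
  simpa [Polynomial.eval_comp] using this

/-! ### The square root of the modulus of a self-adjoint operator -/

section Hilbert

variable {H : Type*} [NormedAddCommGroup H] [InnerProductSpace ℂ H] [CompleteSpace H]

/-- The operator `|A|^{1/2}`. -/
def sqrtAbs (A : H →L[ℂ] H) : H →L[ℂ] H := cfc (fun t : ℝ => √|t|) A

lemma isSelfAdjoint_sqrtAbs (A : H →L[ℂ] H) : IsSelfAdjoint (sqrtAbs A) := cfc_predicate _ _

lemma sqrtAbs_mul_self {A : H →L[ℂ] H} (hA : IsSelfAdjoint A) :
    sqrtAbs A * sqrtAbs A = CFC.abs A := by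
  have hc : Continuous fun t : ℝ => √|t| := by fun_prop
  rw [sqrtAbs, ← cfc_mul _ _ A hc.continuousOn hc.continuousOn, CFC.abs_eq_cfc_norm A hA]
  refine cfc_congr fun t _ => ?_
  simp

/-- Dyadic cutting of √|t| at the levels σ_j = σ₀ 2^{-j}: the slice p_j has size at most σ_j and is
divisible by t, with quotient of size at most 4/σ_j. -/
lemma exists_hasSum_sqrtAbs {A : H →L[ℂ] H} (hA : IsSelfAdjoint A) (u : H) :
    ∃ C : ℝ, 0 < C ∧ ∃ h : ℕ → H, (∀ j, ‖h j‖ ≤ C * 2 ^ j) ∧ (∀ j, ‖A (h j)‖ ≤ C * (1 / 2) ^ j) ∧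
      HasSum (fun j => A (h j)) (sqrtAbs A u) := by
  -- This makes √|t| ≤ σ₀ on the spectrum of `A`, so the telescoping sum starts at `sqrtAbs A`.
  set σ₀ : ℝ := √(‖A‖ + 1) with hσ₀
  have hσ₀pos : 0 < σ₀ := Real.sqrt_pos.2 (by positivity)
  let σ : ℕ → ℝ := fun j => σ₀ * (1 / 2) ^ j
  have hσ : ∀ j, 0 < σ j := fun j => by positivity
  have hσs : ∀ j, σ (j + 1) = σ j / 2 := fun j => by simp only [σ, pow_succ]; ring
  let m : ℕ → ℝ → ℝ := fun j t => min √|t| (σ j)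
  let p : ℕ → ℝ → ℝ := fun j t => m j t - m (j + 1) t
  -- A continuous version of p_j(t)/t: where √|t| ≤ σ_{j+1} the slice p_j vanishes, and elsewhere
  -- the maximum is t². The bound is σ_j/σ_{j+1}² = 4/σ_j.
  let r : ℕ → ℝ → ℝ := fun j t => p j t * (t / max (t ^ 2) (σ (j + 1) ^ 4))
  have hm : ∀ j, Continuous (m j) := fun j => by fun_prop
  have hp : ∀ j, Continuous (p j) := fun j => (hm j).sub (hm (j + 1))
  have hr : ∀ j, Continuous (r j) := fun j => by
    refine (hp j).mul (continuous_id.div (by fun_prop) fun t => ?_)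
    exact (lt_max_of_lt_right (pow_pos (hσ _) 4)).ne'
  have hzero : ∀ j t, √|t| ≤ σ (j + 1) → p j t = 0 := fun j t ht => by
    have : √|t| ≤ σ j := ht.trans (by rw [hσs]; linarith [hσ j])
    simp [p, m, min_eq_left ht, min_eq_left this]
  have hp0 : ∀ j t, 0 ≤ p j t := fun j t =>
    sub_nonneg.2 (min_le_min_left _ (by rw [hσs]; linarith [hσ j]))
  have hp1 : ∀ j t, p j t ≤ σ j := fun j t => by
    have h1 : 0 ≤ m (j + 1) t := le_min (Real.sqrt_nonneg _) (hσ _).le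
    have h2 : m j t ≤ σ j := min_le_right _ _
    simp only [p]; linarith
  have hlarge : ∀ j t, ¬ √|t| ≤ σ (j + 1) →
      σ (j + 1) ^ 2 < |t| ∧ max (t ^ 2) (σ (j + 1) ^ 4) = |t| ^ 2 := fun j t ht => by
    have h1 : σ (j + 1) ^ 2 < |t| := (Real.lt_sqrt (hσ _).le).1 (not_le.1 ht)
    refine ⟨h1, ?_⟩
    rw [max_eq_left, sq_abs]
    have : (σ (j + 1) ^ 2) ^ 2 ≤ |t| ^ 2 := by gcongr
    rw [sq_abs] at this
    linarith [this, (by ring : σ (j + 1) ^ 4 = (σ (j + 1) ^ 2) ^ 2)]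
  have hrp : ∀ j t, t * r j t = p j t := fun j t => by
    by_cases ht : √|t| ≤ σ (j + 1)
    · simp [r, hzero j t ht]
    · obtain ⟨h1, h2⟩ := hlarge j t ht
      have h3 : t ≠ 0 := abs_pos.1 ((sq_nonneg _).trans_lt h1)
      simp only [r, h2, sq_abs]
      field_simp
  have hrb : ∀ j t, |r j t| ≤ 4 / σ j := fun j t => by
    by_cases ht : √|t| ≤ σ (j + 1)
    · simp only [r, hzero j t ht, zero_mul, abs_zero]; exact (div_pos (by norm_num) (hσ j)).le
    · obtain ⟨h1, h2⟩ := hlarge j t ht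
      have h3 : 0 < |t| := (sq_nonneg _).trans_lt h1
      simp only [r, h2]
      rw [abs_mul, abs_div, abs_of_nonneg (hp0 j t), abs_of_nonneg (sq_nonneg |t|)]
      have : |t| / |t| ^ 2 = 1 / |t| := by field_simp
      rw [this, mul_one_div, div_le_div_iff₀ h3 (hσ j)]
      rw [hσs] at h1
      nlinarith [hp1 j t, hσ j, hp0 j t]
  let h : ℕ → H := fun j => cfc (r j) A u
  have hAh : ∀ j, A (h j) = cfc (p j) A u := fun j => by
    have : A * cfc (r j) A = cfc (p j) A := by
      nth_rw 1 [← cfc_id' ℝ A]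
      rw [← cfc_mul (fun t : ℝ => t) (r j) A continuous_id.continuousOn (hr j).continuousOn]
      simp only [hrp]
    rw [← this]; rfl
  have hnorm : ∀ (f : ℝ → ℝ) (c : ℝ), 0 ≤ c → (∀ t ∈ spectrum ℝ A, |f t| ≤ c) →
      ‖cfc f A u‖ ≤ c * ‖u‖ := fun f c hc hf =>
    (cfc f A).le_of_opNorm_le (norm_cfc_le hc hf) u
  refine ⟨(4 / σ₀ + σ₀) * (‖u‖ + 1), by positivity, h, fun j => ?_, fun j => ?_, ?_⟩
  · have h1 := hnorm (r j) (4 / σ j) (div_pos (by norm_num) (hσ j)).le fun t _ => hrb j t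
    have h2 : 4 / σ j = 4 / σ₀ * 2 ^ j := by simp only [σ]; field_simp; simp
    rw [h2] at h1
    calc ‖h j‖ ≤ 4 / σ₀ * 2 ^ j * ‖u‖ := h1
      _ = 4 / σ₀ * ‖u‖ * 2 ^ j := by ring
      _ ≤ (4 / σ₀ + σ₀) * (‖u‖ + 1) * 2 ^ j := by gcongr <;> linarith
  · rw [hAh]
    have h1 := hnorm (p j) (σ j) (hσ j).le fun t _ => by
      rw [abs_of_nonneg (hp0 j t)]; exact hp1 j t
    calc ‖cfc (p j) A u‖ ≤ σ j * ‖u‖ := h1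
      _ = σ₀ * ‖u‖ * (1 / 2) ^ j := by simp only [σ]; ring
      _ ≤ (4 / σ₀ + σ₀) * (‖u‖ + 1) * (1 / 2) ^ j := by
        gcongr <;> linarith [div_pos (by norm_num : (0 : ℝ) < 4) hσ₀pos]
  · have hsum : Summable fun j => A (h j) := by
      refine Summable.of_norm_bounded (g := fun j => σ₀ * ‖u‖ * (1 / 2) ^ j)
        ((summable_geometric_of_lt_one (by norm_num) (by norm_num)).mul_left _) fun j => ?_
      rw [hAh]
      refine (hnorm (p j) (σ j) (hσ j).le fun t _ => by
        rw [abs_of_nonneg (hp0 j t)]; exact hp1 j t).trans (le_of_eq ?_)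
      simp only [σ]; ring
    refine (hsum.hasSum_iff_tendsto_nat).2 ?_
    have hpart : ∀ n, ∑ j ∈ Finset.range n, A (h j) = sqrtAbs A u - cfc (m n) A u := by
      have h0 : sqrtAbs A = cfc (m 0) A := by
        refine cfc_congr fun t ht => ?_
        have h1 : |t| ≤ ‖A‖ + 1 := by
          have h2 := spectrum.norm_le_norm_mul_of_mem ht
          have h3 : ‖(1 : H →L[ℂ] H)‖ ≤ 1 := ContinuousLinearMap.norm_id_le
          rw [Real.norm_eq_abs] at h2
          nlinarith [norm_nonneg A]
        simp only [m, σ, pow_zero, mul_one]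
        rw [min_eq_left (Real.sqrt_le_sqrt h1)]
      intro n
      induction n with
      | zero => simp [h0]
      | succ n ih =>
        rw [Finset.sum_range_succ, ih, hAh]
        have : cfc (p n) A = cfc (m n) A - cfc (m (n + 1)) A :=
          cfc_sub _ _ A (hm n).continuousOn (hm (n + 1)).continuousOn
        rw [this, sub_apply]; abel
    simp_rw [hpart]
    have hlim : Tendsto (fun n => cfc (m n) A u) atTop (𝓝 0) := by
      refine squeeze_zero_norm (a := fun n => σ₀ * ‖u‖ * (1 / 2) ^ n) (fun n => ?_) ?_
      · refine (hnorm (m n) (σ n) (hσ n).le fun t _ => ?_).trans (le_of_eq ?_)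
        · rw [abs_of_nonneg (le_min (Real.sqrt_nonneg _) (hσ _).le)]; exact min_le_right _ _
        · simp only [σ]; ring
      · simpa using (tendsto_pow_atTop_nhds_zero_of_lt_one (by norm_num : (0 : ℝ) ≤ 1 / 2)
          (by norm_num)).const_mul (σ₀ * ‖u‖)
    simpa using tendsto_const_nhds.sub hlim

/-! ### The Picard criterion -/

/-- Take u = Σ (c_n/λ_n) S₁ψ_n and v = Σ (c_n/λ_n) S₂ψ_n with c_n the coefficients of φ. As ⟨w,Tw⟩ =
‖S₁w‖² + ‖S₂w‖², the squared norms of the two partial sums add up to Σ |c_n|²/λ_n, so both series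
converge. -/
lemma exists_eq_add_of_picardSum_ne_top {S₁ S₂ T : H →L[ℂ] H} (h₁ : IsSelfAdjoint S₁)
    (h₂ : IsSelfAdjoint S₂) (hT : T = S₁ * S₁ + S₂ * S₂) {lam : ℕ → ℝ} {ψ : ℕ → H}
    (hψ : IsEigensystem T lam ψ) {φ : H} (hφ : picardSum lam ψ φ ≠ ∞) :
    ∃ u v, φ = S₁ u + S₂ v := by
  have hform : ∀ w : H, ‖S₁ w‖ ^ 2 + ‖S₂ w‖ ^ 2 = RCLike.re (inner ℂ w (T w)) := by
    intro w
    have e : ∀ S : H →L[ℂ] H, IsSelfAdjoint S → ‖S w‖ ^ 2 = RCLike.re (inner ℂ w ((S * S) w)) := by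
      intro S hS
      rw [mul_apply_eq_comp, ← ContinuousLinearMap.adjoint_inner_left,
        hS.adjoint_eq, ← norm_sq_eq_re_inner]
    rw [hT, add_apply, inner_add_right, map_add, e S₁ h₁, e S₂ h₂]
  have hlam : ∀ n, 0 ≤ lam n := by
    intro n
    have h := hform (ψ n)
    rw [hψ.eigen, inner_smul_right, inner_self_eq_norm_sq_to_K, hψ.orthonormal.1] at h
    simp at h
    rw [← h]; positivity
  set c : ℕ → ℂ := fun n => inner ℂ (ψ n) φ with hc
  have hterm := ENNReal.ne_top_of_tsum_ne_top hφ
  -- A nonzero coefficient over a zero eigenvalue would make its term ∞. So the real quotients with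
  -- denominator 0, which take the value 0, do no harm below.
  have hzero : ∀ n, lam n = 0 → c n = 0 := by
    intro n hn
    by_contra hne
    refine hterm n ?_
    rw [hn, abs_zero, ENNReal.ofReal_zero, ENNReal.div_zero]
    simpa using hne
  have hsum : Summable fun n => ‖c n‖ ^ 2 / lam n := by
    refine (ENNReal.summable_toReal hφ).congr fun n => ?_
    rw [ENNReal.toReal_div, ENNReal.toReal_ofReal (by positivity),
      ENNReal.toReal_ofReal (abs_nonneg _), abs_of_nonneg (hlam n)]
  set a : ℕ → ℂ := fun n => c n / lam n with ha
  have hnorm : ∀ s : Finset ℕ, ‖∑ n ∈ s, a n • S₁ (ψ n)‖ ^ 2 + ‖∑ n ∈ s, a n • S₂ (ψ n)‖ ^ 2 =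
      ∑ n ∈ s, ‖c n‖ ^ 2 / lam n := by
    intro s
    have h := hform (∑ n ∈ s, a n • ψ n)
    simp only [map_sum, map_smul] at h
    rw [h]
    have e : ∀ n ∈ s, T (ψ n) = (lam n : ℂ) • ψ n := fun n _ => hψ.eigen n
    have e2 : ∑ n ∈ s, a n • T (ψ n) = ∑ n ∈ s, c n • ψ n := by
      refine Finset.sum_congr rfl fun n _ => ?_
      rw [hψ.eigen, smul_smul]
      by_cases hn : lam n = 0
      · simp [hzero n hn, hn]
      · have : (lam n : ℂ) ≠ 0 := by exact_mod_cast hn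
        rw [ha]; simp only; rw [div_mul_cancel₀ _ this]
    rw [e2, hψ.orthonormal.inner_sum, map_sum]
    refine Finset.sum_congr rfl fun n _ => ?_
    simp only [ha, map_div₀, Complex.conj_ofReal]
    rw [div_mul_eq_mul_div, Complex.conj_mul']
    norm_cast
  have hS : ∀ S : H →L[ℂ] H, (∀ s : Finset ℕ, ‖∑ n ∈ s, a n • S (ψ n)‖ ^ 2 ≤
      ∑ n ∈ s, ‖c n‖ ^ 2 / lam n) → Summable fun n => a n • S (ψ n) := by
    intro S hS
    rw [summable_iff_vanishing_norm]
    intro ε hε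
    obtain ⟨s, hs⟩ := summable_iff_vanishing_norm.1 hsum (ε ^ 2) (by positivity)
    refine ⟨s, fun t ht => ?_⟩
    have h1 := (hS t).trans_lt ((le_abs_self _).trans_lt (hs t ht))
    exact lt_of_pow_lt_pow_left₀ 2 hε.le h1
  have hs1 := hS S₁ fun s => by rw [← hnorm s]; exact le_add_of_nonneg_right (by positivity)
  have hs2 := hS S₂ fun s => by rw [← hnorm s]; exact le_add_of_nonneg_left (by positivity)
  refine ⟨∑' n, a n • S₁ (ψ n), ∑' n, a n • S₂ (ψ n), ?_⟩
  have hb := (HilbertBasis.mk hψ.orthonormal hψ.complete.ge).hasSum_repr φ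
  have h3 : HasSum (fun n => c n • ψ n) φ := by
    convert hb using 2 with n
    rw [HilbertBasis.repr_apply_apply, HilbertBasis.coe_mk]
  refine h3.unique ?_
  have h4 := (S₁.hasSum hs1.hasSum).add (S₂.hasSum hs2.hasSum)
  refine h4.congr_fun ?_
  intro n
  have : S₁ (a n • S₁ (ψ n)) + S₂ (a n • S₂ (ψ n)) = a n • T (ψ n) := by
    rw [hT]; simp
  rw [this, hψ.eigen, smul_smul]
  by_cases hn : lam n = 0
  · simp [hzero n hn, hn]
  · have : (lam n : ℂ) ≠ 0 := by exact_mod_cast hn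
    simp only [ha]; rw [div_mul_cancel₀ _ this]

end Hilbert


/-! ### Entire functions that are small on an interval -/

/-- For the substitution z = K/2 + (K/2) cosh w, which maps the line Re w = 0 to [0,K] and the other
vertical lines to ellipses with foci 0 and K. Evenness of cosh allows Re w ≥ 0. -/
lemma exists_cosh_eq (u : ℂ) : ∃ w : ℂ, 0 ≤ w.re ∧ Complex.cosh w = u := by
  obtain ⟨v, hv⟩ := Complex.cos_surjective u
  rw [← Complex.cosh_mul_I] at hv
  rcases le_total 0 (v * Complex.I).re with h | h
  · exact ⟨_, h, hv⟩
  · exact ⟨-(v * Complex.I), by simpa using h, by rw [Complex.cosh_neg, hv]⟩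

lemma cosh_re_im (w : ℂ) : (Complex.cosh w).re = Real.cosh w.re * Real.cos w.im ∧
    (Complex.cosh w).im = Real.sinh w.re * Real.sin w.im := by
  have : Complex.cosh w = ((Real.cosh w.re * Real.cos w.im : ℝ) : ℂ) +
      ((Real.sinh w.re * Real.sin w.im : ℝ) : ℂ) * Complex.I := by
    conv_lhs => rw [← Complex.re_add_im w]
    rw [Complex.cosh_add, Complex.cosh_mul_I, Complex.sinh_mul_I]
    push_cast
    ring
  rw [this]
  constructor
  · rw [Complex.add_re, Complex.re_ofReal_mul, Complex.ofReal_re, Complex.I_re, mul_zero, add_zero]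
  · rw [Complex.add_im, Complex.im_ofReal_mul, Complex.ofReal_im, Complex.I_im, mul_one, zero_add]

lemma norm_cosh_sq (w : ℂ) : ‖Complex.cosh w‖ ^ 2 = Real.sinh w.re ^ 2 + Real.cos w.im ^ 2 := by
  rw [← Complex.normSq_eq_norm_sq, Complex.normSq_apply, (cosh_re_im w).1, (cosh_re_im w).2]
  have h1 := Real.cosh_sq w.re
  have h2 := Real.sin_sq_add_cos_sq w.im
  linear_combination (Real.cos w.im ^ 2) * h1 + Real.sinh w.re ^ 2 * h2

lemma re_le_of_norm_cosh_le {w : ℂ} {y : ℝ} (hy : 0 ≤ y) (h : ‖Complex.cosh w‖ ≤ y) :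
    w.re ≤ Real.log (2 * y + 1) := by
  have h1 : Real.sinh w.re ^ 2 ≤ y ^ 2 := by
    have : ‖Complex.cosh w‖ ^ 2 ≤ y ^ 2 := by gcongr
    rw [norm_cosh_sq] at this
    nlinarith [sq_nonneg (Real.cos w.im)]
  have h2 : Real.sinh w.re ≤ y := le_of_sq_le_sq h1 hy
  rcases le_total w.re 0 with h0 | h0
  · exact h0.trans (Real.log_nonneg (by linarith))
  · rw [Real.le_log_iff_exp_le (by linarith)]
    have h3 := Real.cosh_add_sinh w.re
    have h4 := Real.cosh_sub_sinh w.re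
    have h5 : Real.exp (-w.re) ≤ 1 := Real.exp_le_one_iff.2 (by linarith)
    linarith

/-- With S = sinh²(Re w), eliminating Im w by sin² + cos² = 1 leaves S² ≤ (2d + 2d²)S + d². The
square on the left of the conclusion is due to the branch points ±1, near which distance d in the
plane becomes √d in w. -/
lemma re_sq_le_of_cosh_near {w : ℂ} {d : ℝ} (hd0 : 0 ≤ d) (hd1 : d ≤ 1) (hw : 0 ≤ w.re)
    (hre : |(Complex.cosh w).re| ≤ 1 + d) (him : |(Complex.cosh w).im| ≤ d) :
    w.re ^ 2 ≤ 5 * d := by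
  rw [(cosh_re_im w).1] at hre
  rw [(cosh_re_im w).2] at him
  have hre2 : (Real.cosh w.re * Real.cos w.im) ^ 2 ≤ (1 + d) ^ 2 := sq_le_sq' (abs_le.1 hre).1
    (abs_le.1 hre).2
  have him2 : (Real.sinh w.re * Real.sin w.im) ^ 2 ≤ d ^ 2 := sq_le_sq' (abs_le.1 him).1
    (abs_le.1 him).2
  have hs : w.re ≤ Real.sinh w.re := Real.self_le_sinh_iff.2 hw
  set S := Real.sinh w.re ^ 2 with hS
  have hS0 : 0 ≤ S := sq_nonneg _
  have hc : Real.cosh w.re ^ 2 = S + 1 := Real.cosh_sq w.re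
  have hcs := Real.sin_sq_add_cos_sq w.im
  rw [mul_pow, hc] at hre2
  rw [mul_pow, ← hS] at him2
  have h1 : S * (S + 1) ≤ (1 + d) ^ 2 * S + d ^ 2 * (S + 1) := by
    have e : S * (S + 1) = ((S + 1) * Real.cos w.im ^ 2) * S +
      (S * Real.sin w.im ^ 2) * (S + 1) := by linear_combination -(S * (S + 1)) * hcs
    rw [e]
    gcongr
  have h2 : S ≤ 5 * d := by
    by_contra hlt
    push Not at hlt
    nlinarith [mul_nonneg hd0 hS0, mul_nonneg hd0 (sub_nonneg.2 hd1),
      mul_nonneg (mul_nonneg hd0 hS0) (sub_nonneg.2 hd1)]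
  calc w.re ^ 2 ≤ S := by rw [hS]; gcongr
    _ ≤ 5 * d := h2

/-- A two-constants estimate for ellipses with foci `0` and `K`. -/
lemma norm_le_of_three_lines {G : ℂ → ℂ} (hG : Differentiable ℂ G) {K R ε X θ : ℝ} (hK : 0 < K)
    (hR : 0 < R) (hε : 0 ≤ ε) (hX : 1 ≤ X) (hG0 : ∀ x ∈ Icc (0 : ℝ) K, ‖G x‖ ≤ ε)
    (hG1 : ∀ z, ‖z‖ ≤ K * Real.exp R → ‖G z‖ ≤ ε * X) {w : ℂ} (hw : 0 ≤ w.re)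
    (hwθ : w.re ≤ θ * R) (hθ : θ ≤ 1) :
    ‖G (K / 2 + K / 2 * Complex.cosh w)‖ ≤ ε * X ^ θ := by
  set f : ℂ → ℂ := fun w => G (K / 2 + K / 2 * Complex.cosh w) with hf
  have hfd : Differentiable ℂ f := hG.comp
    ((differentiable_const _).add ((differentiable_const _).mul Complex.differentiable_cosh))
  have hbd : ∀ v : ℂ, 0 ≤ v.re → v.re ≤ R → ‖f v‖ ≤ ε * X := by
    intro v hv0 hv1
    refine hG1 _ ?_
    have h1 : ‖Complex.cosh v‖ ≤ Real.exp R := by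
      have h2 : ‖Complex.cosh v‖ ^ 2 ≤ Real.exp R ^ 2 := by
        rw [norm_cosh_sq]
        have h3 : Real.sinh v.re ^ 2 + Real.cos v.im ^ 2 ≤ Real.cosh v.re ^ 2 := by
          rw [Real.cosh_sq]; linarith [Real.cos_sq_le_one v.im]
        refine h3.trans ?_
        have h4 : Real.cosh v.re ≤ Real.exp R := by
          have h5 := Real.cosh_add_sinh v.re
          have h6 : 0 ≤ Real.sinh v.re := Real.sinh_nonneg_iff.2 hv0
          have h7 := Real.exp_le_exp.2 hv1
          linarith
        have := Real.cosh_pos v.re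
        gcongr
      exact le_of_sq_le_sq h2 (Real.exp_pos R).le
    have h8 : (1 : ℝ) ≤ Real.exp R := Real.one_le_exp hR.le
    have hKn : ‖(K : ℂ) / 2‖ = K / 2 := by
      rw [norm_div, Complex.norm_real, Real.norm_of_nonneg hK.le]; norm_num
    calc ‖(K : ℂ) / 2 + K / 2 * Complex.cosh v‖ ≤ K / 2 + K / 2 * ‖Complex.cosh v‖ := by
          refine (norm_add_le _ _).trans ?_
          rw [norm_mul, hKn]
      _ ≤ K * Real.exp R := by nlinarith
  have hl : ∀ v ∈ Complex.re ⁻¹' {(0 : ℝ)}, ‖f v‖ ≤ ε := by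
    intro v hv
    have hv0 : v.re = 0 := hv
    have h1 : Complex.cosh v = ((Real.cos v.im : ℝ) : ℂ) := by
      apply Complex.ext
      · rw [(cosh_re_im v).1, hv0, Complex.ofReal_re, Real.cosh_zero, one_mul]
      · rw [(cosh_re_im v).2, hv0]; simp
    have h2 : (K : ℂ) / 2 + K / 2 * Complex.cosh v =
        ((K / 2 + K / 2 * Real.cos v.im : ℝ) : ℂ) := by rw [h1]; push_cast; ring
    simp only [hf]
    rw [h2]
    refine hG0 _ ⟨?_, ?_⟩
    · nlinarith [Real.neg_one_le_cos v.im]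
    · nlinarith [Real.cos_le_one v.im]
  have hr : ∀ v ∈ Complex.re ⁻¹' {R}, ‖f v‖ ≤ ε * X := by
    intro v hv
    have hv0 : v.re = R := hv
    exact hbd v (by rw [hv0]; exact hR.le) hv0.le
  have hmem : w ∈ Complex.HadamardThreeLines.verticalClosedStrip 0 R := by
    refine ⟨hw, hwθ.trans ?_⟩
    nlinarith
  have h := Complex.HadamardThreeLines.norm_le_interp_of_mem_verticalClosedStrip' hR hmem
    hfd.diffContOnCl ⟨ε * X, by
      rintro _ ⟨v, hv, rfl⟩
      exact hbd v hv.1 hv.2⟩ hl hr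
  refine h.trans ?_
  simp only [sub_zero]
  have h0 : 0 ≤ w.re / R := by positivity
  have h1 : w.re / R ≤ θ := (div_le_iff₀ hR).2 hwθ
  rw [Real.mul_rpow hε (by linarith), ← mul_assoc]
  gcongr
  rw [← Real.rpow_add' hε (by norm_num), sub_add_cancel, Real.rpow_one]

/-- The three lines theorem needs a uniform bound on [0,K], which an integral norm gives for the
primitive G but not for f; Cauchy's estimates then return from G to f. The two bounds on G differ by
a factor 4^j, so interpolation costs (4^j)^θ: bounded for θ = 1/(j+1), used near [0,K], and at most
(3/2)^j for θ = 1/4, used everywhere. -/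
lemma exists_bound_of_small_primitive {K a C : ℝ} (hK : 0 < K) (ha : 0 ≤ a) (hC : 0 < C) :
    ∃ B : ℝ, 0 < B ∧ ∀ (j : ℕ) (f : ℂ → ℂ), Differentiable ℂ f →
      (∀ z, ‖f z‖ ≤ C * 2 ^ j * Real.exp (a * ‖z‖)) →
      (∀ x ∈ Icc (0 : ℝ) K, ‖∫ t in (0 : ℝ)..x, f t‖ ≤ C * (1 / 2) ^ j) →
      (∀ (n : ℕ), ∀ x ∈ Icc (0 : ℝ) K,
        ‖iteratedDeriv n f x‖ ≤ (n + 1).factorial * B ^ (n + 2) * ((j : ℝ) + 1) ^ (2 * n + 2) *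
          (1 / 2) ^ j) ∧
      ∀ z, ‖f z‖ ≤ B * (3 / 4) ^ j * Real.exp (B * (1 + ‖z‖) ^ 4) := by
  set b : ℝ := (a + 1) * K with hb
  have hb0 : 0 < b := by positivity
  set B₁ : ℝ := 4 * Real.exp (b * Real.exp 1) * C with hB₁
  set c₀ : ℝ := 4 / K + 3 with hc₀
  set B : ℝ := B₁ + 10 / K + C + b / 4 * c₀ ^ 4 with hB
  have hB₁0 : 0 < B₁ := by positivity
  have hBpos : 0 < B := by positivity
  refine ⟨B, hBpos, fun j f hf hfC hfp => ?_⟩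
  obtain ⟨G, hG0, hG⟩ := hf.isExactOn_univ.with_val_at 0 0
  have hG' : ∀ z, HasDerivAt G (f z) z := fun z => hG z (mem_univ z)
  have hGd : Differentiable ℂ G := fun z => (hG' z).differentiableAt
  have hderiv : deriv G = f := funext fun z => (hG' z).deriv
  have hGreal : ∀ x ∈ Icc (0 : ℝ) K, ‖G x‖ ≤ C * (1 / 2) ^ j := by
    intro x hx
    have : ∫ t in (0 : ℝ)..x, f t = G x - G (0 : ℝ) := by
      refine intervalIntegral.integral_eq_sub_of_hasDerivAt (f := fun t : ℝ => G t)
        (fun t _ => (hG' t).comp_ofReal) ?_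
      exact (hf.continuous.comp Complex.continuous_ofReal).intervalIntegrable _ _
    rw [Complex.ofReal_zero, hG0, sub_zero] at this
    rw [← this]
    exact hfp x hx
  have hGall : ∀ z, ‖G z‖ ≤ C * 2 ^ j * Real.exp ((a + 1) * ‖z‖) := by
    intro z
    have h1 := (convex_closedBall (0 : ℂ) ‖z‖).norm_image_sub_le_of_norm_hasDerivWithin_le
      (f := G) (f' := f) (C := C * 2 ^ j * Real.exp (a * ‖z‖)) (x := 0) (y := z)
      (fun v _ => (hG' v).hasDerivWithinAt) (fun v hv => (hfC v).trans (by
        have : ‖v‖ ≤ ‖z‖ := by simpa using hv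
        gcongr)) (by simp) (by simp)
    rw [hG0, sub_zero, sub_zero] at h1
    refine h1.trans ?_
    -- The length ‖z‖ of the path of integration is absorbed by raising the exponential type from a
    -- to a + 1.
    have h2 : ‖z‖ ≤ Real.exp ‖z‖ := by linarith [Real.add_one_le_exp ‖z‖]
    calc C * 2 ^ j * Real.exp (a * ‖z‖) * ‖z‖ ≤
        C * 2 ^ j * Real.exp (a * ‖z‖) * Real.exp ‖z‖ := by gcongr
      _ = C * 2 ^ j * Real.exp ((a + 1) * ‖z‖) := by
        rw [mul_assoc, ← Real.exp_add]; congr 2; ring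
  have hlines : ∀ {R θ : ℝ} {w : ℂ}, 0 < R → 0 ≤ w.re → w.re ≤ θ * R → θ ≤ 1 →
      ‖G (K / 2 + K / 2 * Complex.cosh w)‖ ≤
        C * (1 / 2) ^ j * (4 ^ j * Real.exp (b * Real.exp R)) ^ θ := by
    intro R θ w hR hw hwθ hθ
    refine norm_le_of_three_lines hGd hK hR (by positivity) ?_ hGreal (fun z hz => ?_) hw hwθ hθ
    · exact one_le_mul_of_one_le_of_one_le (one_le_pow₀ (by norm_num))
        (Real.one_le_exp (by positivity))
    · refine (hGall z).trans ?_
      have h1 : (a + 1) * ‖z‖ ≤ b * Real.exp R := by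
        rw [hb, mul_assoc]; gcongr
      have h2 : C * (1 / 2) ^ j * (4 ^ j * Real.exp (b * Real.exp R)) =
          C * 2 ^ j * Real.exp (b * Real.exp R) := by
        have : (1 / 2 : ℝ) ^ j * 4 ^ j = 2 ^ j := by rw [← mul_pow]; norm_num
        rw [← this]; ring
      rw [h2]
      gcongr
  have hcenter : ∀ z : ℂ, ∃ w : ℂ, 0 ≤ w.re ∧ Complex.cosh w = 2 / K * z - 1 ∧
      z = K / 2 + K / 2 * Complex.cosh w := by
    intro z
    obtain ⟨w, hw, hwz⟩ := exists_cosh_eq (2 / K * z - 1)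
    refine ⟨w, hw, hwz, ?_⟩
    rw [hwz]
    have : (K : ℂ) ≠ 0 := by exact_mod_cast hK.ne'
    field_simp
    ring
  have hj : (0 : ℝ) < (j : ℝ) + 1 := by positivity
  constructor
  · intro n x hx
    -- Chosen so that 5d = (j+1)^{-2}: then `re_sq_le_of_cosh_near` gives Re w ≤ 1/(j+1) on the
    -- circle, which is θR with R = 1.
    set d : ℝ := 1 / (5 * ((j : ℝ) + 1) ^ 2) with hd
    have hd0 : 0 < d := by positivity
    have hd1 : d ≤ 1 := by
      rw [hd, div_le_one (by positivity)]
      have : (1 : ℝ) ≤ (j : ℝ) + 1 := by linarith [(Nat.cast_nonneg j : (0 : ℝ) ≤ j)]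
      nlinarith
    have hsph : ∀ z ∈ Metric.sphere (x : ℂ) (K / 2 * d), ‖G z‖ ≤ B₁ * (1 / 2) ^ j := by
      intro z hz
      obtain ⟨w, hw, hwz, hzw⟩ := hcenter z
      rw [mem_sphere_iff_norm] at hz
      have h1 : (2 / K : ℂ) * z - 1 = ((2 / K * x - 1 : ℝ) : ℂ) + ((2 / K : ℝ) : ℂ) * (z - x) := by
        push_cast; ring
      have h2 : ‖((2 / K : ℝ) : ℂ) * (z - x)‖ = d := by
        rw [norm_mul, Complex.norm_real, hz, Real.norm_of_nonneg (by positivity)]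
        field_simp
      have h3 : |2 / K * x - 1| ≤ 1 := by
        have e1 : 2 / K * x ≤ 2 / K * K := by gcongr; exact hx.2
        rw [div_mul_cancel₀ _ hK.ne'] at e1
        have e2 : 0 ≤ 2 / K * x := mul_nonneg (by positivity) hx.1
        rw [abs_le]; constructor <;> linarith
      have h4 := re_sq_le_of_cosh_near (w := w) hd0.le hd1 hw (by
          rw [hwz, h1, Complex.add_re, Complex.ofReal_re]
          refine (abs_add_le _ _).trans (add_le_add h3 ?_)
          rw [← h2]; exact Complex.abs_re_le_norm _) (by
          rw [hwz, h1, Complex.add_im, Complex.ofReal_im, zero_add, ← h2]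
          exact Complex.abs_im_le_norm _)
      have h5 : w.re ≤ 1 / ((j : ℝ) + 1) * 1 := by
        rw [mul_one]
        refine le_of_sq_le_sq (h4.trans (le_of_eq ?_)) (by positivity)
        rw [hd]; field_simp
      have h6 := hlines one_pos hw h5 (by rw [div_le_one hj]; linarith [(Nat.cast_nonneg j : (0 : ℝ) ≤ j)])
      rw [← hzw] at h6
      refine h6.trans ?_
      have h7 : (4 ^ j * Real.exp (b * Real.exp 1)) ^ (1 / ((j : ℝ) + 1)) ≤
          4 * Real.exp (b * Real.exp 1) := by
        have e1 : (4 ^ j * Real.exp (b * Real.exp 1)) ≤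
            (4 * Real.exp (b * Real.exp 1)) ^ ((j : ℝ) + 1) := by
          rw [← Nat.cast_succ, Real.rpow_natCast, mul_pow]
          have : (1 : ℝ) ≤ Real.exp (b * Real.exp 1) := Real.one_le_exp (by positivity)
          gcongr
          · norm_num
          · exact Nat.le_succ j
          · exact le_self_pow₀ this (Nat.succ_ne_zero j)
        calc _ ≤ ((4 * Real.exp (b * Real.exp 1)) ^ ((j : ℝ) + 1)) ^ (1 / ((j : ℝ) + 1)) := by
              gcongr
          _ = _ := by
            rw [← Real.rpow_mul (by positivity), mul_one_div_cancel hj.ne', Real.rpow_one]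
      calc _ ≤ C * (1 / 2) ^ j * (4 * Real.exp (b * Real.exp 1)) := by gcongr
        _ = B₁ * (1 / 2) ^ j := by rw [hB₁]; ring
    -- The n-th derivative of f is the (n+1)-st of G, hence the shifted factorial and exponents.
    have h8 := Complex.norm_iteratedDeriv_le_of_forall_mem_sphere_norm_le (n + 1)
      (by positivity : 0 < K / 2 * d) hGd.diffContOnCl hsph
    rw [iteratedDeriv_succ', hderiv] at h8
    refine h8.trans ?_
    have h9 : (K / 2 * d)⁻¹ = 10 / K * ((j : ℝ) + 1) ^ 2 := by
      rw [hd]; field_simp; norm_num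
    rw [div_eq_mul_inv, ← inv_pow, h9, mul_pow, ← pow_mul]
    have h10 : B₁ * (10 / K) ^ (n + 1) ≤ B ^ (n + 2) := by
      rw [pow_succ B (n + 1), mul_comm (B ^ (n + 1))]
      have e1 : 0 < 10 / K := by positivity
      have e2 : 0 < b / 4 * c₀ ^ 4 := by positivity
      gcongr
      · linarith
      · linarith
    calc ((n + 1).factorial : ℝ) * (B₁ * (1 / 2) ^ j) *
          ((10 / K) ^ (n + 1) * ((j : ℝ) + 1) ^ (2 * (n + 1))) =
          (n + 1).factorial * (B₁ * (10 / K) ^ (n + 1)) * ((j : ℝ) + 1) ^ (2 * n + 2) *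
            (1 / 2) ^ j := by rw [mul_add]; ring
      _ ≤ _ := by gcongr
  · intro z
    -- Bounds |cosh w| on the unit circle around z, where Cauchy's estimate for f = G' is taken.
    set y : ℝ := 2 / K * (‖z‖ + 1) + 1 with hy
    have hy1 : 1 < y := by
      have : 0 < 2 / K * (‖z‖ + 1) := by positivity
      linarith
    have hlog : 0 < Real.log (2 * y + 1) := Real.log_pos (by linarith)
    have hsph : ∀ v ∈ Metric.sphere z 1, ‖G v‖ ≤ C * (3 / 4) ^ j * Real.exp (b / 4 * (2 * y + 1) ^ 4) := by
      intro v hv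
      obtain ⟨w, hw, hwz, hzw⟩ := hcenter v
      rw [mem_sphere_iff_norm] at hv
      have h1 : ‖Complex.cosh w‖ ≤ y := by
        rw [hwz]
        refine (norm_sub_le _ _).trans ?_
        have e1 : ‖v‖ ≤ ‖z‖ + 1 := by
          have := norm_le_norm_add_norm_sub' v z
          linarith
        rw [norm_mul, norm_one, norm_div, Complex.norm_real, Real.norm_of_nonneg hK.le]
        simp only [Complex.norm_ofNat]
        rw [hy]
        gcongr
      have h2 := re_le_of_norm_cosh_le (by linarith) h1
      -- R is four times the bound on Re w, so θ = 1/4 is admissible; e^R = (2y+1)^4 is the source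
      -- of the fourth power.
      have h3 := hlines (R := 4 * Real.log (2 * y + 1)) (θ := 1 / 4) (by positivity) hw
        (by linarith) (by norm_num)
      rw [← hzw] at h3
      refine h3.trans ?_
      have h4 : Real.exp (4 * Real.log (2 * y + 1)) = (2 * y + 1) ^ 4 := by
        rw [mul_comm, ← Real.rpow_def_of_pos (by linarith)]
        norm_cast
      have h5 : (4 : ℝ) ^ (1 / 4 : ℝ) ≤ 3 / 2 := by
        calc (4 : ℝ) ^ (1 / 4 : ℝ) ≤ ((3 / 2 : ℝ) ^ (4 : ℝ)) ^ (1 / 4 : ℝ) := by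
              gcongr; norm_num
          _ = 3 / 2 := by rw [← Real.rpow_mul (by norm_num)]; norm_num
      rw [h4, Real.mul_rpow (by positivity) (by positivity), ← Real.exp_mul, ← Real.rpow_natCast,
        ← Real.rpow_natCast, ← Real.rpow_natCast, ← Real.rpow_mul (by norm_num),
        mul_comm (j : ℝ) (1 / 4), Real.rpow_mul (by norm_num)]
      rw [Real.rpow_natCast, Real.rpow_natCast, Real.rpow_natCast]
      calc C * (1 / 2) ^ j * (((4 : ℝ) ^ (1 / 4 : ℝ)) ^ j * Real.exp (b * (2 * y + 1) ^ 4 * (1 / 4)))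
          ≤ C * (1 / 2) ^ j * ((3 / 2) ^ j * Real.exp (b * (2 * y + 1) ^ 4 * (1 / 4))) := by gcongr
        _ = C * ((1 / 2) * (3 / 2)) ^ j * Real.exp (b / 4 * (2 * y + 1) ^ 4) := by
          rw [mul_pow, (by ring : b * (2 * y + 1) ^ 4 * (1 / 4) = b / 4 * (2 * y + 1) ^ 4)]; ring
        _ = _ := by norm_num
    have h6 := Complex.norm_deriv_le_of_forall_mem_sphere_norm_le one_pos hGd.diffContOnCl hsph
    rw [hderiv, div_one] at h6
    refine h6.trans ?_
    have e0 : 0 < 10 / K := by positivity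
    have e2 : 0 < b / 4 * c₀ ^ 4 := by positivity
    have h7 : 2 * y + 1 ≤ c₀ * (1 + ‖z‖) := by
      rw [hy, hc₀]
      have : 0 ≤ 3 * ‖z‖ := by positivity
      have e : 2 * (2 / K * (‖z‖ + 1) + 1) + 1 = (4 / K) * (1 + ‖z‖) + 3 := by ring
      rw [e]
      linarith
    have h8 : b / 4 * (2 * y + 1) ^ 4 ≤ B * (1 + ‖z‖) ^ 4 := by
      calc b / 4 * (2 * y + 1) ^ 4 ≤ b / 4 * (c₀ * (1 + ‖z‖)) ^ 4 := by gcongr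
        _ = b / 4 * c₀ ^ 4 * (1 + ‖z‖) ^ 4 := by ring
        _ ≤ B * (1 + ‖z‖) ^ 4 := by gcongr; linarith
    have h9 : C ≤ B := by linarith
    gcongr


/-! ### Exponential integrals -/

/-- The function `z ↦ ∫ e^{izξ} b(ξ) dν(ξ)`. -/
def expInt (ν : Measure ℝ) (b : ℝ → ℂ) (z : ℂ) : ℂ := ∫ ξ, Complex.exp (Complex.I * z * ξ) * b ξ ∂ν

section ExpInt

variable {ν : Measure ℝ} {b : ℝ → ℂ} {a : ℝ}

lemma norm_exp_I_mul (z : ℂ) (ξ : ℝ) :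
    ‖Complex.exp (Complex.I * z * ξ)‖ = Real.exp (-(z.im * ξ)) := by
  rw [Complex.norm_exp]
  simp

lemma norm_exp_I_mul_le {z : ℂ} {ξ : ℝ} (hξ : |ξ| ≤ a) :
    ‖Complex.exp (Complex.I * z * ξ)‖ ≤ Real.exp (a * ‖z‖) := by
  rw [norm_exp_I_mul]
  refine Real.exp_le_exp.2 ((neg_le_abs _).trans ?_)
  rw [abs_mul, mul_comm]
  exact mul_le_mul hξ (Complex.abs_im_le_norm z) (abs_nonneg _) ((abs_nonneg _).trans hξ)

lemma integrable_exp_mul (hν : ∀ᵐ ξ ∂ν, |ξ| ≤ a) (hb : Integrable b ν) (z : ℂ) :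
    Integrable (fun ξ : ℝ => Complex.exp (Complex.I * z * ξ) * b ξ) ν := by
  refine hb.bdd_mul (c := Real.exp (a * ‖z‖)) (by fun_prop) ?_
  filter_upwards [hν] with ξ hξ using norm_exp_I_mul_le hξ

lemma norm_expInt_le (hν : ∀ᵐ ξ ∂ν, |ξ| ≤ a) (hb : Integrable b ν) (z : ℂ) :
    ‖expInt ν b z‖ ≤ Real.exp (a * ‖z‖) * ∫ ξ, ‖b ξ‖ ∂ν := by
  rw [← integral_const_mul]
  refine norm_integral_le_of_norm_le (hb.norm.const_mul _) ?_
  filter_upwards [hν] with ξ hξ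
  rw [norm_mul]
  exact mul_le_mul_of_nonneg_right (norm_exp_I_mul_le hξ) (norm_nonneg _)

lemma integrable_mul_of_ae_bound (hν : ∀ᵐ ξ ∂ν, |ξ| ≤ a) (hb : Integrable b ν) {g : ℝ → ℂ}
    (hg : Continuous g) : Integrable (fun ξ => g ξ * b ξ) ν := by
  obtain ⟨C, hC⟩ := (isCompact_Icc (a := -a) (b := a)).exists_bound_of_continuousOn hg.continuousOn
  refine hb.bdd_mul (c := C) hg.aestronglyMeasurable ?_
  filter_upwards [hν] with ξ hξ using hC ξ (abs_le.1 hξ)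

lemma hasDerivAt_expInt (hν : ∀ᵐ ξ ∂ν, |ξ| ≤ a) (hb : Integrable b ν) (z : ℂ) :
    HasDerivAt (expInt ν b) (expInt ν (fun ξ => Complex.I * ξ * b ξ) z) z := by
  have ha : ∀ᵐ ξ ∂ν, 0 ≤ a := by filter_upwards [hν] with ξ hξ using (abs_nonneg ξ).trans hξ
  have hb' : Integrable (fun ξ : ℝ => Complex.I * ξ * b ξ) ν :=
    integrable_mul_of_ae_bound hν hb (by fun_prop)
  refine (hasDerivAt_integral_of_dominated_loc_of_deriv_le
    (F := fun (z : ℂ) (ξ : ℝ) => Complex.exp (Complex.I * z * ξ) * b ξ)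
    (F' := fun (z : ℂ) (ξ : ℝ) => Complex.exp (Complex.I * z * ξ) * (Complex.I * ξ * b ξ))
    (bound := fun ξ => Real.exp (a * (‖z‖ + 1)) * ‖Complex.I * ξ * b ξ‖)
    (Metric.ball_mem_nhds z one_pos)
    (Eventually.of_forall fun w => (integrable_exp_mul hν hb w).aestronglyMeasurable)
    (integrable_exp_mul hν hb z) (integrable_exp_mul hν hb' z).aestronglyMeasurable ?_
    (hb'.norm.const_mul _) ?_).2
  · filter_upwards [hν, ha] with ξ hξ ha w hw
    rw [norm_mul]
    have h1 : ‖w‖ ≤ ‖z‖ + 1 := by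
      have h2 := norm_le_norm_add_norm_sub' w z
      rw [mem_ball_iff_norm] at hw
      linarith
    refine mul_le_mul_of_nonneg_right ((norm_exp_I_mul_le hξ).trans ?_) (norm_nonneg _)
    gcongr
  · refine Eventually.of_forall fun ξ w _ => ?_
    have h1 : HasDerivAt (fun w : ℂ => Complex.I * w * ξ) (Complex.I * ξ) w := by
      simpa using ((hasDerivAt_id w).const_mul Complex.I).mul_const (ξ : ℂ)
    exact (h1.cexp.mul_const (b ξ)).congr_deriv (by ring)

lemma differentiable_expInt (hν : ∀ᵐ ξ ∂ν, |ξ| ≤ a) (hb : Integrable b ν) :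
    Differentiable ℂ (expInt ν b) := fun z => (hasDerivAt_expInt hν hb z).differentiableAt

lemma iteratedDeriv_expInt (hν : ∀ᵐ ξ ∂ν, |ξ| ≤ a) (n : ℕ) (hb : Integrable b ν) :
    iteratedDeriv n (expInt ν b) = expInt ν (fun ξ => (Complex.I * ξ) ^ n * b ξ) := by
  induction n generalizing b with
  | zero => simp
  | succ n ih =>
    have h : deriv (expInt ν b) = expInt ν (fun ξ => Complex.I * ξ * b ξ) :=
      funext fun z => (hasDerivAt_expInt hν hb z).deriv
    rw [iteratedDeriv_succ', h, ih (integrable_mul_of_ae_bound hν hb (by fun_prop))]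
    congr 1
    ext ξ
    ring

/-- Multiplying the density by ξ is the same as applying -i d/dz to the integral. -/
lemma expInt_polynomial_mul (hν : ∀ᵐ ξ ∂ν, |ξ| ≤ a) (hb : Integrable b ν) (q : Polynomial ℝ)
    (z : ℂ) : expInt ν (fun ξ => ((q.eval ξ : ℝ) : ℂ) * b ξ) z =
      ∑ n ∈ Finset.range (q.natDegree + 1),
        (q.coeff n : ℂ) * (-Complex.I) ^ n * iteratedDeriv n (expInt ν b) z := by
  have h1 : ∀ n : ℕ, (q.coeff n : ℂ) * (-Complex.I) ^ n * iteratedDeriv n (expInt ν b) z =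
      ∫ ξ : ℝ, (q.coeff n : ℂ) * (-Complex.I) ^ n *
        (Complex.exp (Complex.I * z * ξ) * ((Complex.I * ξ) ^ n * b ξ)) ∂ν := by
    intro n
    rw [iteratedDeriv_expInt hν n hb, expInt, integral_const_mul]
  simp_rw [h1]
  rw [← integral_finsetSum]
  · refine integral_congr_ae (Eventually.of_forall fun ξ => ?_)
    simp only
    rw [Polynomial.eval_eq_sum_range]
    push_cast
    rw [Finset.sum_mul, Finset.mul_sum]
    refine Finset.sum_congr rfl fun n _ => ?_
    have h2 : (-Complex.I) ^ n * (Complex.I * ξ) ^ n = (ξ : ℂ) ^ n := by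
      rw [← mul_pow, ← mul_assoc, neg_mul, Complex.I_mul_I, neg_neg, one_mul]
    linear_combination (-((q.coeff n : ℂ)) * Complex.exp (Complex.I * z * ξ) * b ξ) * h2
  · intro n _
    exact (integrable_exp_mul hν (integrable_mul_of_ae_bound hν hb (by fun_prop)) z).const_mul _

/-- On the imaginary axis the kernel is e^{-sξ}, monotone in ξ, so its maximum over [α,β] sits at an
endpoint. This keeps the exact exponents that `norm_expInt_le` loses. -/
lemma norm_expInt_I_mul_le {α β : ℝ} (hν : ∀ᵐ ξ ∂ν, ξ ∈ Icc α β) (hb : Integrable b ν) (s : ℝ) :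
    ‖expInt ν b (Complex.I * s)‖ ≤
      max (Real.exp (-(s * α))) (Real.exp (-(s * β))) * ∫ ξ, ‖b ξ‖ ∂ν := by
  rw [← integral_const_mul]
  refine norm_integral_le_of_norm_le (hb.norm.const_mul _) ?_
  filter_upwards [hν] with ξ hξ
  rw [norm_mul, norm_exp_I_mul]
  refine mul_le_mul_of_nonneg_right ?_ (norm_nonneg _)
  have h1 : (Complex.I * (s : ℂ)).im = s := by simp
  rw [h1]
  rcases le_total 0 s with hs | hs
  · exact le_max_of_le_left (Real.exp_le_exp.2 (by nlinarith [hξ.1]))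
  · exact le_max_of_le_right (Real.exp_le_exp.2 (by nlinarith [hξ.2]))

end ExpInt

/-! ### The finite Fourier transform on `L²(0,K)` -/

section Fourier

variable {K : ℝ}

lemma integrable_L2 (h : L2 K) : Integrable h (volume.restrict (Ioo (0 : ℝ) K)) :=
  memLp_one_iff_integrable.1 ((Lp.memLp h).mono_exponent (by norm_num))

lemma exists_integral_norm_le (K : ℝ) : ∃ C : ℝ, 0 < C ∧ ∀ h : L2 K,
    ∫ s in Ioo (0 : ℝ) K, ‖h s‖ ≤ C * ‖h‖ := by
  set μ := volume.restrict (Ioo (0 : ℝ) K) with hμ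
  set A : ℝ := (μ univ ^ (1 / (1 : ℝ≥0∞).toReal - 1 / (2 : ℝ≥0∞).toReal)).toReal with hA
  refine ⟨A + 1, by positivity, fun h => ?_⟩
  have h3 := eLpNorm_le_eLpNorm_mul_rpow_measure_univ (μ := μ) (p := 1) (q := 2) (by norm_num)
    (Lp.aestronglyMeasurable h)
  have h4 : ∫ s, ‖h s‖ ∂μ ≤ A * ‖h‖ := by
    rw [integral_norm_eq_lintegral_enorm (Lp.aestronglyMeasurable h),
      ← eLpNorm_one_eq_lintegral_enorm, Lp.norm_def, mul_comm, hA, ← ENNReal.toReal_mul]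
    refine ENNReal.toReal_mono (ENNReal.mul_ne_top (Lp.memLp h).2.ne ?_) h3
    exact ENNReal.rpow_ne_top_of_nonneg (by norm_num) (measure_ne_top _ _)
  linarith [norm_nonneg h]

lemma memLp_of_continuous {f : ℝ → ℂ} (hf : Continuous f) :
    MemLp f 2 (volume.restrict (Ioo (0 : ℝ) K)) := by
  obtain ⟨C, hC⟩ := (isCompact_Icc (a := 0) (b := K)).exists_bound_of_continuousOn hf.continuousOn
  refine MemLp.of_bound hf.aestronglyMeasurable C ?_
  filter_upwards [ae_restrict_mem measurableSet_Ioo] with k hk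
  exact hC k (Ioo_subset_Icc_self hk)

lemma inner_toLp {f : ℝ → ℂ} (hf : MemLp f 2 (volume.restrict (Ioo (0 : ℝ) K))) (g : L2 K) :
    inner ℂ g (hf.toLp f) = ∫ s in Ioo (0 : ℝ) K, (starRingEnd ℂ) (g s) * f s := by
  rw [L2.inner_def]
  refine integral_congr_ae ?_
  filter_upwards [hf.coeFn_toLp] with s hs
  rw [hs, RCLike.inner_apply, mul_comm]

lemma inner_L2 (g h : L2 K) :
    inner ℂ g h = ∫ s in Ioo (0 : ℝ) K, (starRingEnd ℂ) (g s) * h s := by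
  rw [L2.inner_def]
  refine integral_congr_ae (Eventually.of_forall fun s => ?_)
  simp only [RCLike.inner_apply, mul_comm]

/-- The finite Fourier transform `ξ ↦ ∫_0^K e^{-isξ} h(s) ds`. -/
def finFourier (h : L2 K) (ξ : ℝ) : ℂ :=
  ∫ s in Ioo (0 : ℝ) K, Complex.exp (-(Complex.I * s * ξ)) * h s

lemma norm_exp_neg_I_mul (s ξ : ℝ) : ‖Complex.exp (-(Complex.I * s * ξ))‖ = 1 := by
  have : -(Complex.I * (s : ℂ) * ξ) = ((-(s * ξ) : ℝ) : ℂ) * Complex.I := by push_cast; ring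
  rw [this, Complex.norm_exp_ofReal_mul_I]

lemma norm_finFourier_le (h : L2 K) (ξ : ℝ) :
    ‖finFourier h ξ‖ ≤ ∫ s in Ioo (0 : ℝ) K, ‖h s‖ := by
  refine norm_integral_le_of_norm_le (integrable_L2 h).norm (Eventually.of_forall fun s => ?_)
  rw [norm_mul, norm_exp_neg_I_mul, one_mul]

lemma continuous_finFourier (h : L2 K) : Continuous (finFourier h) := by
  refine continuous_of_dominated (bound := fun s => ‖h s‖) (fun ξ => ?_) (fun ξ => ?_)
    (integrable_L2 h).norm ?_
  · exact (Continuous.aestronglyMeasurable (by fun_prop)).mul (Lp.aestronglyMeasurable h)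
  · refine Eventually.of_forall fun s => ?_
    rw [norm_mul, norm_exp_neg_I_mul, one_mul]
  · exact Eventually.of_forall fun s => by fun_prop

lemma integrable_mul_finFourier {ν : Measure ℝ} [IsFiniteMeasure ν] {a : ℝ}
    (hν : ∀ᵐ ξ ∂ν, |ξ| ≤ a) {c : ℝ → ℂ} (hc : Continuous c) (h : L2 K) :
    Integrable (fun ξ => c ξ * finFourier h ξ) ν :=
  integrable_mul_of_ae_bound hν (Integrable.of_bound (continuous_finFourier h).aestronglyMeasurable
    _ (Eventually.of_forall (norm_finFourier_le h))) hc

/-- Fubini's theorem: `expInt` is the adjoint L of the finite Fourier transform L^*. -/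
lemma integral_conj_mul_expInt {ν : Measure ℝ} [IsFiniteMeasure ν] {b : ℝ → ℂ}
    (hb : Integrable b ν) (g : L2 K) :
    ∫ s in Ioo (0 : ℝ) K, (starRingEnd ℂ) (g s) * expInt ν b s =
      ∫ ξ, (starRingEnd ℂ) (finFourier g ξ) * b ξ ∂ν := by
  have h2 : Integrable (fun s => (starRingEnd ℂ) (g s)) (volume.restrict (Ioo (0 : ℝ) K)) :=
    Complex.conjCLE.toContinuousLinearMap.integrable_comp (integrable_L2 g)
  have h1 : Integrable (Function.uncurry fun s ξ : ℝ => Complex.exp (Complex.I * s * ξ) *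
      ((starRingEnd ℂ) (g s) * b ξ)) ((volume.restrict (Ioo (0 : ℝ) K)).prod ν) := by
    refine (h2.mul_prod hb).bdd_mul (c := 1)
      (f := fun z : ℝ × ℝ => Complex.exp (Complex.I * z.1 * z.2)) (by fun_prop)
      (Eventually.of_forall fun z => ?_)
    rw [norm_exp_I_mul]
    simp
  calc ∫ s in Ioo (0 : ℝ) K, (starRingEnd ℂ) (g s) * expInt ν b s
      = ∫ s : ℝ in Ioo (0 : ℝ) K, ∫ ξ : ℝ, Complex.exp (Complex.I * s * ξ) *
          ((starRingEnd ℂ) (g s) * b ξ) ∂ν := by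
        refine integral_congr_ae (Eventually.of_forall fun s => ?_)
        simp only [expInt]
        rw [← integral_const_mul]
        congr 1
        ext ξ
        ring
    _ = ∫ ξ : ℝ, (∫ s : ℝ in Ioo (0 : ℝ) K, Complex.exp (Complex.I * s * ξ) *
          ((starRingEnd ℂ) (g s) * b ξ)) ∂ν := integral_integral_swap h1
    _ = ∫ ξ : ℝ, (starRingEnd ℂ) (finFourier g ξ) * b ξ ∂ν := by
        refine integral_congr_ae (Eventually.of_forall fun ξ => ?_)
        simp only [finFourier]
        rw [← integral_conj, ← integral_mul_const]
        refine integral_congr_ae (Eventually.of_forall fun s => ?_)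
        simp only [map_mul, ← Complex.exp_conj, map_neg, Complex.conj_I, Complex.conj_ofReal,
          neg_mul, neg_neg]
        ring

/-! ### Operators with an exponential-integral kernel -/

/-- `A = L c L^*`, where `L^*` is the finite Fourier transform into `L²(ν)` and `c` acts by
multiplication. -/
def IsExpOp (ν : Measure ℝ) (c : ℝ → ℂ) (A : L2 K →L[ℂ] L2 K) : Prop :=
  ∀ g h : L2 K, inner ℂ g (A h) = ∫ ξ, (starRingEnd ℂ) (finFourier g ξ) * (c ξ * finFourier h ξ) ∂ν

lemma IsExpOp.coeFn {ν : Measure ℝ} [IsFiniteMeasure ν] {a : ℝ} (hν : ∀ᵐ ξ ∂ν, |ξ| ≤ a)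
    {c : ℝ → ℂ} (hc : Continuous c) {A : L2 K →L[ℂ] L2 K} (hA : IsExpOp ν c A) (h : L2 K) :
    A h =ᵐ[volume.restrict (Ioo (0 : ℝ) K)]
      fun s : ℝ => expInt ν (fun ξ => c ξ * finFourier h ξ) s := by
  have hb := integrable_mul_finFourier hν hc h
  have hcont : Continuous fun s : ℝ => expInt ν (fun ξ => c ξ * finFourier h ξ) s :=
    (differentiable_expInt hν hb).continuous.comp Complex.continuous_ofReal
  have hm := memLp_of_continuous (K := K) hcont
  have : A h = hm.toLp _ := by
    refine ext_inner_left ℂ fun g => ?_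
    rw [hA, inner_toLp, integral_conj_mul_expInt hb]
  rw [this]
  exact hm.coeFn_toLp

lemma isExpOp_of_coeFn {ν : Measure ℝ} [IsFiniteMeasure ν] {a : ℝ} (hν : ∀ᵐ ξ ∂ν, |ξ| ≤ a)
    {c : ℝ → ℂ} (hc : Continuous c) {A : L2 K →L[ℂ] L2 K}
    (hA : ∀ h : L2 K, A h =ᵐ[volume.restrict (Ioo (0 : ℝ) K)]
      fun s : ℝ => expInt ν (fun ξ => c ξ * finFourier h ξ) s) : IsExpOp ν c A := by
  intro g h
  rw [inner_L2, ← integral_conj_mul_expInt (integrable_mul_finFourier hν hc h)]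
  refine integral_congr_ae ?_
  filter_upwards [hA h] with s hs
  rw [hs]

lemma IsExpOp.adjoint {ν : Measure ℝ} {c : ℝ → ℂ} {A : L2 K →L[ℂ] L2 K} (hA : IsExpOp ν c A) :
    IsExpOp ν (fun ξ => (starRingEnd ℂ) (c ξ)) (star A) := by
  intro g h
  rw [ContinuousLinearMap.star_eq_adjoint, ContinuousLinearMap.adjoint_inner_right,
    ← inner_conj_symm, hA, ← integral_conj]
  refine integral_congr_ae (Eventually.of_forall fun ξ => ?_)
  simp only [map_mul, Complex.conj_conj]
  ring

lemma IsExpOp.linearCombination {ν : Measure ℝ} [IsFiniteMeasure ν] {a : ℝ}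
    (hν : ∀ᵐ ξ ∂ν, |ξ| ≤ a) {c d : ℝ → ℂ} (hc : Continuous c) (hd : Continuous d)
    {A B : L2 K →L[ℂ] L2 K} (hA : IsExpOp ν c A) (hB : IsExpOp ν d B) (r s : ℂ) :
    IsExpOp ν (fun ξ => r * c ξ + s * d ξ) (r • A + s • B) := by
  have hi : ∀ {e : ℝ → ℂ}, Continuous e → ∀ g h : L2 K, Integrable
      (fun ξ => (starRingEnd ℂ) (finFourier g ξ) * (e ξ * finFourier h ξ)) ν := fun he g h =>
    integrable_mul_of_ae_bound hν (integrable_mul_finFourier hν he h)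
      (Complex.continuous_conj.comp (continuous_finFourier g))
  intro g h
  rw [add_apply, smul_apply, smul_apply, inner_add_right, inner_smul_right, inner_smul_right,
    hA, hB, ← integral_const_mul, ← integral_const_mul,
    ← integral_add ((hi hc g h).const_mul r) ((hi hd g h).const_mul s)]
  refine integral_congr_ae (Eventually.of_forall fun ξ => ?_)
  ring

/-- Taking the adjoint conjugates the symbol, so the real part of the operator has the real part of
the symbol. -/
lemma isExpOp_realPart {ν : Measure ℝ} [IsFiniteMeasure ν] {a : ℝ} (hν : ∀ᵐ ξ ∂ν, |ξ| ≤ a)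
    {k : ℝ} {F : L2 K →L[ℂ] L2 K} (hF : IsExpOp ν (fun ξ => Complex.exp (Complex.I * k * ξ)) F) :
    IsExpOp ν (fun ξ => ((Real.cos (k * ξ) : ℝ) : ℂ)) (realPart F : L2 K →L[ℂ] L2 K) := by
  have h := hF.linearCombination hν (by fun_prop) (by fun_prop) hF.adjoint (1 / 2) (1 / 2)
  have e1 : (realPart F : L2 K →L[ℂ] L2 K) = (1 / 2 : ℂ) • F + (1 / 2 : ℂ) • star F := by
    rw [realPart_apply_coe, ← smul_add, ← Complex.coe_smul]
    norm_num
  have e2 : (fun ξ : ℝ => ((Real.cos (k * ξ) : ℝ) : ℂ)) = fun ξ : ℝ =>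
      (1 / 2 : ℂ) * Complex.exp (Complex.I * k * ξ) +
        1 / 2 * (starRingEnd ℂ) (Complex.exp (Complex.I * k * ξ)) := by
    ext ξ
    rw [← Complex.exp_conj, Complex.ofReal_cos, Complex.cos]
    simp only [map_mul, Complex.conj_I, Complex.conj_ofReal]
    push_cast
    rw [(by ring : Complex.I * (k : ℂ) * ξ = k * ξ * Complex.I),
      (by ring : -Complex.I * (k : ℂ) * ξ = -(k * ξ) * Complex.I)]
    ring
  rw [e1, e2]
  exact h

lemma isExpOp_imaginaryPart {ν : Measure ℝ} [IsFiniteMeasure ν] {a : ℝ} (hν : ∀ᵐ ξ ∂ν, |ξ| ≤ a)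
    {k : ℝ} {F : L2 K →L[ℂ] L2 K} (hF : IsExpOp ν (fun ξ => Complex.exp (Complex.I * k * ξ)) F) :
    IsExpOp ν (fun ξ => ((Real.sin (k * ξ) : ℝ) : ℂ)) (imaginaryPart F : L2 K →L[ℂ] L2 K) := by
  have h := hF.linearCombination hν (by fun_prop) (by fun_prop) hF.adjoint
    (-Complex.I / 2) (Complex.I / 2)
  have e1 : (imaginaryPart F : L2 K →L[ℂ] L2 K) =
      (-Complex.I / 2 : ℂ) • F + (Complex.I / 2 : ℂ) • star F := by
    rw [imaginaryPart_apply_coe, ← Complex.coe_smul, smul_smul, smul_sub, sub_eq_add_neg,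
      ← neg_smul]
    congr 2 <;> (push_cast; ring)
  have e2 : (fun ξ : ℝ => ((Real.sin (k * ξ) : ℝ) : ℂ)) = fun ξ : ℝ =>
      (-Complex.I / 2 : ℂ) * Complex.exp (Complex.I * k * ξ) +
        Complex.I / 2 * (starRingEnd ℂ) (Complex.exp (Complex.I * k * ξ)) := by
    ext ξ
    rw [← Complex.exp_conj, Complex.ofReal_sin, Complex.sin]
    simp only [map_mul, Complex.conj_I, Complex.conj_ofReal]
    push_cast
    rw [(by ring : Complex.I * (k : ℂ) * ξ = k * ξ * Complex.I),
      (by ring : -Complex.I * (k : ℂ) * ξ = -(k * ξ) * Complex.I)]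
    ring
  rw [e1, e2]
  exact h

end Fourier


/-! ### The range of `|A|^{1/2}` -/

/-- With n = j+1 and t = (1+|s|)^4, the crossover is n = 8(B+a)t. Below it, powers of n are powers
of t. Above it, (3/4)^j ≤ (4/3)e^{-n/4}: one factor e^{-n/8} absorbs n², the other turns e^{Bt} into
at most e^{-at} ≤ m. The factor 1/(j+1)² makes the bound summable in j. -/
lemma exists_summable_bound {a B C : ℝ} (ha : 0 ≤ a) (hB : 0 ≤ B) (hC : 0 ≤ C) (p : ℕ) :
    ∃ D : ℝ, 0 ≤ D ∧ ∀ (j : ℕ) (s m x : ℝ), Real.exp (-(a * |s|)) ≤ m →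
      x ≤ C * ((j : ℝ) + 1) ^ p * m → x ≤ B * (3 / 4) ^ j * Real.exp (B * (1 + |s|) ^ 4) →
      x ≤ D * (1 + |s|) ^ (4 * (p + 2)) * m * (1 / ((j : ℝ) + 1) ^ 2) := by
  set E : ℝ := 8 * (B + a) with hE
  have hE0 : 0 ≤ E := by positivity
  refine ⟨C * E ^ (p + 2) + 4 / 3 * 128 * B, by positivity, fun j s m x hm h1 h2 => ?_⟩
  have hm0 : 0 < m := (Real.exp_pos _).trans_le hm
  set n : ℝ := (j : ℝ) + 1 with hn
  have hn0 : 0 < n := by positivity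
  set t : ℝ := (1 + |s|) ^ 4 with ht
  have hs1 : 1 ≤ 1 + |s| := by linarith [abs_nonneg s]
  have ht1 : 1 ≤ t := one_le_pow₀ hs1
  have hts : |s| ≤ t := by
    have : 1 + |s| ≤ t := le_self_pow₀ hs1 (by norm_num)
    linarith
  rw [pow_mul, ← ht, mul_one_div, le_div_iff₀ (by positivity)]
  rcases le_total n (E * t) with hcase | hcase
  · calc x * n ^ 2 ≤ C * n ^ p * m * n ^ 2 := by gcongr
      _ = C * n ^ (p + 2) * m := by ring
      _ ≤ C * (E * t) ^ (p + 2) * m := by gcongr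
      _ = C * E ^ (p + 2) * t ^ (p + 2) * m := by rw [mul_pow]; ring
      _ ≤ _ := by
        gcongr
        have : 0 ≤ 4 / 3 * 128 * B := by positivity
        linarith
  · have e1 : (3 / 4 : ℝ) ≤ Real.exp (-(1 / 4)) := by
      have := Real.add_one_le_exp (-(1 / 4) : ℝ)
      linarith
    have e2 : (3 / 4 : ℝ) ^ j ≤ 4 / 3 * Real.exp (-(n / 4)) := by
      have : (3 / 4 : ℝ) ^ (j + 1) ≤ Real.exp (-(n / 4)) := by
        calc (3 / 4 : ℝ) ^ (j + 1) ≤ Real.exp (-(1 / 4)) ^ (j + 1) := by gcongr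
          _ = Real.exp (-(n / 4)) := by rw [← Real.exp_nat_mul]; congr 1; push_cast; ring
      rw [pow_succ] at this
      linarith
    have e3 : Real.exp (-(n / 8)) * n ^ 2 ≤ 128 := by
      have h3 := Real.quadratic_le_exp_of_nonneg (by positivity : 0 ≤ n / 8)
      rw [Real.exp_neg, inv_mul_le_iff₀ (Real.exp_pos _)]
      nlinarith
    have e4 : Real.exp (-(n / 8)) * Real.exp (B * t) ≤ m := by
      refine le_trans ?_ hm
      rw [← Real.exp_add]
      refine Real.exp_le_exp.2 ?_
      have : a * |s| ≤ a * t := by gcongr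
      nlinarith
    calc x * n ^ 2 ≤ B * (3 / 4) ^ j * Real.exp (B * t) * n ^ 2 := by gcongr
      _ ≤ B * (4 / 3 * Real.exp (-(n / 4))) * Real.exp (B * t) * n ^ 2 := by gcongr
      _ = 4 / 3 * B * (Real.exp (-(n / 8)) * n ^ 2) * (Real.exp (-(n / 8)) * Real.exp (B * t)) := by
        have : Real.exp (-(n / 4)) = Real.exp (-(n / 8)) * Real.exp (-(n / 8)) := by
          rw [← Real.exp_add]; congr 1; ring
        rw [this]; ring
      _ ≤ 4 / 3 * B * 128 * m := by gcongr
      _ = 4 / 3 * 128 * B * 1 * m := by ring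
      _ ≤ _ := by
        gcongr
        · have : 0 ≤ C * E ^ (p + 2) := by positivity
          linarith
        · exact one_le_pow₀ ht1

/-- Since c² ≤ q c, the integral of |c ĥ|² is at most that of q c |ĥ|², a pairing of h with q(-i
d/ds) applied to the exponential integral. Carried back to (0,K), the factor 2^j of ‖h‖ cancels the
(1/2)^j of the derivatives, and only a power of j+1 survives. -/
lemma integral_norm_le_of_polynomial {K : ℝ} {ν : Measure ℝ} [IsFiniteMeasure ν] {a : ℝ}
    (hν : ∀ᵐ ξ ∂ν, |ξ| ≤ a) {c : ℝ → ℝ} (hc : Continuous c) {q : Polynomial ℝ}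
    (hq : ∀ ξ, |ξ| ≤ a → c ξ ^ 2 ≤ q.eval ξ * c ξ) {B AK : ℝ} (hB : 0 ≤ B) (hAK : 0 ≤ AK)
    (hAKle : ∀ h : L2 K, ∫ s in Ioo (0 : ℝ) K, ‖h s‖ ≤ AK * ‖h‖) (C₀ : ℝ) (hC₀ : 0 ≤ C₀) :
    ∃ C : ℝ, 0 ≤ C ∧ ∀ (j : ℕ) (h : L2 K), ‖h‖ ≤ C₀ * 2 ^ j →
      (∀ (n : ℕ), ∀ x ∈ Icc (0 : ℝ) K,
        ‖iteratedDeriv n (expInt ν (fun ξ => (c ξ : ℂ) * finFourier h ξ)) x‖ ≤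
          (n + 1).factorial * B ^ (n + 2) * ((j : ℝ) + 1) ^ (2 * n + 2) * (1 / 2) ^ j) →
      ∫ ξ, ‖(c ξ : ℂ) * finFourier h ξ‖ ∂ν ≤ C * ((j : ℝ) + 1) ^ (2 * q.natDegree + 2) := by
  set N := q.natDegree with hN
  set C₁ : ℝ := ∑ n ∈ Finset.range (N + 1), |q.coeff n| * ((n + 1).factorial * B ^ (n + 2)) with hC₁
  have hC₁0 : 0 ≤ C₁ := Finset.sum_nonneg fun n _ => by positivity
  refine ⟨ν.real univ + C₁ * AK * C₀, by positivity, fun j h hh hder => ?_⟩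
  set b : ℝ → ℂ := fun ξ => (c ξ : ℂ) * finFourier h ξ with hb
  have hcC : Continuous fun ξ => (c ξ : ℂ) := Complex.continuous_ofReal.comp hc
  have hbi : Integrable b ν := integrable_mul_finFourier hν hcC h
  have hqb : Integrable (fun ξ => ((q.eval ξ : ℝ) : ℂ) * b ξ) ν :=
    integrable_mul_of_ae_bound hν hbi (Complex.continuous_ofReal.comp q.continuous)
  set J : ℝ := ((j : ℝ) + 1) ^ (2 * N + 2) with hJ
  have hj1 : (1 : ℝ) ≤ (j : ℝ) + 1 := by linarith [(Nat.cast_nonneg j : (0 : ℝ) ≤ j)]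
  have hJ1 : 1 ≤ J := one_le_pow₀ hj1
  have hpt : ∀ x ∈ Icc (0 : ℝ) K, ‖expInt ν (fun ξ => ((q.eval ξ : ℝ) : ℂ) * b ξ) x‖ ≤
      C₁ * J * (1 / 2) ^ j := by
    intro x hx
    rw [expInt_polynomial_mul hν hbi, hC₁, Finset.sum_mul, Finset.sum_mul]
    refine norm_sum_le_of_le _ fun n hn => ?_
    rw [norm_mul, norm_mul, norm_pow, norm_neg, Complex.norm_I, one_pow, mul_one,
      Complex.norm_real, Real.norm_eq_abs]
    have hnN : n ≤ N := Nat.lt_succ_iff.1 (Finset.mem_range.1 hn)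
    calc |q.coeff n| * ‖iteratedDeriv n (expInt ν b) x‖ ≤ |q.coeff n| *
          ((n + 1).factorial * B ^ (n + 2) * ((j : ℝ) + 1) ^ (2 * n + 2) * (1 / 2) ^ j) := by
          gcongr; exact hder n x hx
      _ ≤ |q.coeff n| * ((n + 1).factorial * B ^ (n + 2) * J * (1 / 2) ^ j) := by
          gcongr
          exact pow_le_pow_right₀ hj1 (by omega)
      _ = _ := by ring
  have hpair : ‖∫ ξ, (starRingEnd ℂ) (finFourier h ξ) * (((q.eval ξ : ℝ) : ℂ) * b ξ) ∂ν‖ ≤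
      C₁ * AK * C₀ * J := by
    rw [← integral_conj_mul_expInt hqb]
    have h1 : ‖∫ s in Ioo (0 : ℝ) K, (starRingEnd ℂ) (h s) *
        expInt ν (fun ξ => ((q.eval ξ : ℝ) : ℂ) * b ξ) s‖ ≤
        ∫ s in Ioo (0 : ℝ) K, ‖h s‖ * (C₁ * J * (1 / 2) ^ j) := by
      refine norm_integral_le_of_norm_le ((integrable_L2 h).norm.mul_const _) ?_
      filter_upwards [ae_restrict_mem measurableSet_Ioo] with s hs
      rw [norm_mul, RCLike.norm_conj]
      gcongr
      exact hpt s (Ioo_subset_Icc_self hs)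
    refine h1.trans ?_
    rw [integral_mul_const]
    calc (∫ s in Ioo (0 : ℝ) K, ‖h s‖) * (C₁ * J * (1 / 2) ^ j) ≤
          (AK * (C₀ * 2 ^ j)) * (C₁ * J * (1 / 2) ^ j) := by
          gcongr
          exact (hAKle h).trans (by gcongr)
      _ = C₁ * AK * C₀ * J * ((2 : ℝ) ^ j * (1 / 2) ^ j) := by ring
      _ = C₁ * AK * C₀ * J := by rw [← mul_pow]; norm_num
  have hreal : ∫ ξ, (starRingEnd ℂ) (finFourier h ξ) * (((q.eval ξ : ℝ) : ℂ) * b ξ) ∂ν =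
      ((∫ ξ, q.eval ξ * c ξ * ‖finFourier h ξ‖ ^ 2 ∂ν : ℝ) : ℂ) := by
    rw [← integral_complex_ofReal]
    refine integral_congr_ae (Eventually.of_forall fun ξ => ?_)
    simp only [hb]
    push_cast
    rw [← Complex.conj_mul']
    ring
  rw [hreal, Complex.norm_real] at hpair
  have hint : Integrable (fun ξ => q.eval ξ * c ξ * ‖finFourier h ξ‖ ^ 2) ν := by
    have h1 : Integrable (fun ξ => (starRingEnd ℂ) (finFourier h ξ) *
        (((q.eval ξ : ℝ) : ℂ) * b ξ)) ν :=
      integrable_mul_of_ae_bound hν hqb (Complex.continuous_conj.comp (continuous_finFourier h))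
    refine h1.re.congr (Eventually.of_forall fun ξ => ?_)
    have : (starRingEnd ℂ) (finFourier h ξ) * (((q.eval ξ : ℝ) : ℂ) * b ξ) =
        ((q.eval ξ * c ξ * ‖finFourier h ξ‖ ^ 2 : ℝ) : ℂ) := by
      simp only [hb]
      push_cast
      rw [← Complex.conj_mul']
      ring
    simp only [this]
    exact Complex.ofReal_re _
  calc ∫ ξ, ‖b ξ‖ ∂ν ≤ ∫ ξ, (1 + q.eval ξ * c ξ * ‖finFourier h ξ‖ ^ 2) ∂ν := by
        refine integral_mono_ae hbi.norm ((integrable_const 1).add hint) ?_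
        filter_upwards [hν] with ξ hξ
        have h1 : ‖b ξ‖ ^ 2 ≤ q.eval ξ * c ξ * ‖finFourier h ξ‖ ^ 2 := by
          simp only [hb]
          rw [norm_mul, mul_pow, Complex.norm_real, Real.norm_eq_abs, sq_abs]
          exact mul_le_mul_of_nonneg_right (hq ξ hξ) (sq_nonneg _)
        -- The elementary |b| ≤ 1 + |b|² passes from the square to the L¹ norm; `ν` is finite.
        nlinarith [sq_nonneg (‖b ξ‖ - 1), sq_nonneg ‖b ξ‖]
    _ = ν.real univ + ∫ ξ, q.eval ξ * c ξ * ‖finFourier h ξ‖ ^ 2 ∂ν := by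
        rw [integral_add (integrable_const 1) hint]; simp
    _ ≤ ν.real univ * J + C₁ * AK * C₀ * J := by
        refine add_le_add (le_mul_of_one_le_right (by positivity) hJ1) ?_
        exact (Real.le_norm_self _).trans hpair
    _ = _ := by ring

/-- Elements of the range of `|L c L^*|^{1/2}`, with `c` a sine, extend to entire functions whose
growth on the imaginary axis is that of the exponentials `e^{izξ}` with `ξ ∈ [α,β]`, up to a
polynomial factor. -/
lemma exists_entire_extension {K : ℝ} (hK : 0 < K) {ν : Measure ℝ} [IsFiniteMeasure ν] {α β : ℝ}
    (hν : ∀ᵐ ξ ∂ν, ξ ∈ Icc α β) {k θ : ℝ} {A : L2 K →L[ℂ] L2 K} (hAsa : IsSelfAdjoint A)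
    (hA : IsExpOp ν (fun ξ => ((Real.sin (k * ξ + θ) : ℝ) : ℂ)) A) (u : L2 K) :
    ∃ f : ℂ → ℂ, Differentiable ℂ f ∧
      (sqrtAbs A u =ᵐ[volume.restrict (Ioo (0 : ℝ) K)] fun s : ℝ => f s) ∧
      ∃ (D : ℝ) (P : ℕ), ∀ s : ℝ, ‖f (Complex.I * s)‖ ≤
        D * (1 + |s|) ^ P * max (Real.exp (-(s * α))) (Real.exp (-(s * β))) := by
  set a : ℝ := max |α| |β| with ha
  have ha0 : 0 ≤ a := (abs_nonneg α).trans (le_max_left _ _)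
  have hνa : ∀ᵐ ξ ∂ν, |ξ| ≤ a := by
    filter_upwards [hν] with ξ hξ using abs_le_max_abs_abs hξ.1 hξ.2
  set c : ℝ → ℝ := fun ξ => Real.sin (k * ξ + θ) with hc
  have hcc : Continuous c := by fun_prop
  have hcC : Continuous fun ξ => (c ξ : ℂ) := Complex.continuous_ofReal.comp hcc
  obtain ⟨q, hq⟩ := exists_polynomial_sin_affine_sq_le k θ a
  obtain ⟨AK, hAK, hAKle⟩ := exists_integral_norm_le K
  obtain ⟨C₀, hC₀, h, hh, hAh, hsum⟩ := exists_hasSum_sqrtAbs hAsa u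
  set b : ℕ → ℝ → ℂ := fun j ξ => (c ξ : ℂ) * finFourier (h j) ξ with hb
  have hbi : ∀ j, Integrable (b j) ν := fun j => integrable_mul_finFourier hνa hcC (h j)
  set f : ℕ → ℂ → ℂ := fun j => expInt ν (b j) with hf
  have hfd : ∀ j, Differentiable ℂ (f j) := fun j => differentiable_expInt hνa (hbi j)
  have hfA : ∀ j, A (h j) =ᵐ[volume.restrict (Ioo (0 : ℝ) K)] fun s : ℝ => f j s :=
    fun j => hA.coeFn hνa hcC (h j)
  -- One constant for both inputs: the growth on ℂ and the smallness of the primitives.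
  set C : ℝ := ν.real univ * (AK * C₀) + AK * C₀ with hC
  have hCpos : 0 < C := by positivity
  have hgrow : ∀ j z, ‖f j z‖ ≤ C * 2 ^ j * Real.exp (a * ‖z‖) := by
    intro j z
    refine (norm_expInt_le hνa (hbi j) z).trans ?_
    rw [mul_comm]
    gcongr
    calc ∫ ξ, ‖b j ξ‖ ∂ν ≤ ∫ _, AK * (C₀ * 2 ^ j) ∂ν := by
          refine integral_mono (hbi j).norm (integrable_const _) fun ξ => ?_
          simp only [hb, norm_mul, Complex.norm_real, hc]
          have h1 : ‖Real.sin (k * ξ + θ)‖ ≤ 1 := Real.abs_sin_le_one _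
          have h2 : ‖finFourier (h j) ξ‖ ≤ AK * (C₀ * 2 ^ j) :=
            (norm_finFourier_le _ _).trans ((hAKle _).trans (by gcongr; exact hh j))
          calc _ ≤ 1 * (AK * (C₀ * 2 ^ j)) := by gcongr
            _ = _ := one_mul _
      _ = ν.real univ * (AK * C₀) * 2 ^ j := by
          rw [integral_const, smul_eq_mul]; ring
      _ ≤ C * 2 ^ j := by
          gcongr
          have : 0 < AK * C₀ := by positivity
          linarith
  have hprim : ∀ j, ∀ x ∈ Icc (0 : ℝ) K, ‖∫ t in (0 : ℝ)..x, f j t‖ ≤ C * (1 / 2) ^ j := by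
    intro j x hx
    have hcont : Continuous fun t : ℝ => f j t := (hfd j).continuous.comp Complex.continuous_ofReal
    calc ‖∫ t in (0 : ℝ)..x, f j t‖ ≤ ∫ t in (0 : ℝ)..x, ‖f j t‖ :=
          intervalIntegral.norm_integral_le_integral_norm hx.1
      _ ≤ ∫ t in (0 : ℝ)..K, ‖f j t‖ := by
          refine intervalIntegral.integral_mono_interval le_rfl hx.1 hx.2
            (Eventually.of_forall fun t => norm_nonneg _) (hcont.norm.intervalIntegrable _ _)
      _ = ∫ t in Ioo (0 : ℝ) K, ‖A (h j) t‖ := by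
          rw [intervalIntegral.integral_of_le hK.le, integral_Ioc_eq_integral_Ioo]
          refine integral_congr_ae ?_
          filter_upwards [hfA j] with t ht
          rw [ht]
      _ ≤ AK * (C₀ * (1 / 2) ^ j) := (hAKle _).trans (by gcongr; exact hAh j)
      _ ≤ C * (1 / 2) ^ j := by
          rw [← mul_assoc]
          gcongr
          have : 0 ≤ ν.real univ * (AK * C₀) := by positivity
          linarith
  obtain ⟨B, hB, hBj⟩ := exists_bound_of_small_primitive hK ha0 hCpos
  have hnear := fun j => (hBj j (f j) (hfd j) (hgrow j) (hprim j)).1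
  have hfar := fun j => (hBj j (f j) (hfd j) (hgrow j) (hprim j)).2
  obtain ⟨C₂, hC₂, hL1⟩ := integral_norm_le_of_polynomial hνa hcc hq hB.le hAK.le hAKle C₀ hC₀.le
  obtain ⟨D, hD, hDj⟩ := exists_summable_bound ha0 hB.le hC₂ (2 * q.natDegree + 2)
  -- The sharp exponents with a polynomial factor in j meet the global decay (3/4)^j;
  -- `exists_summable_bound` merges them.
  have haxis : ∀ j (s : ℝ), ‖f j (Complex.I * s)‖ ≤ D * (1 + |s|) ^ (4 * (2 * q.natDegree + 2 + 2)) *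
      max (Real.exp (-(s * α))) (Real.exp (-(s * β))) * (1 / ((j : ℝ) + 1) ^ 2) := by
    intro j s
    refine hDj j s _ _ ?_ ?_ ?_
    · refine le_max_of_le_left (Real.exp_le_exp.2 ?_)
      have h1 : s * α ≤ |s| * |α| := by rw [← abs_mul]; exact le_abs_self _
      have h2 : |s| * |α| ≤ |s| * a := by gcongr; exact le_max_left _ _
      linarith [mul_comm a |s|]
    · refine (norm_expInt_I_mul_le hν (hbi j) s).trans ?_
      rw [mul_comm]
      gcongr
      exact hL1 j (h j) (hh j) (hnear j)
    · refine (hfar j _).trans (le_of_eq ?_)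
      simp
  have hlocal : ∀ r : ℝ, ∀ j, ∀ z : ℂ, ‖z‖ ≤ r →
      ‖f j z‖ ≤ B * (3 / 4) ^ j * Real.exp (B * (1 + r) ^ 4) := fun r j z hz =>
    (hfar j z).trans (by gcongr)
  have hgeo : ∀ r : ℝ, Summable fun j : ℕ => B * (3 / 4 : ℝ) ^ j * Real.exp (B * (1 + r) ^ 4) :=
    fun r => ((summable_geometric_of_lt_one (by norm_num) (by norm_num)).mul_left B).mul_right _
  have hdiff : Differentiable ℂ fun z => ∑' j, f j z := by
    intro z
    refine (Complex.differentiableOn_tsum_of_summable_norm (hgeo (‖z‖ + 1))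
      (fun j => (hfd j).differentiableOn) (Metric.isOpen_ball (x := (0 : ℂ)) (ε := ‖z‖ + 1))
      fun j w hw => hlocal _ j w (by simpa using (mem_ball_zero_iff.1 hw).le)).differentiableAt
      (Metric.isOpen_ball.mem_nhds (by simp))
  have hcont : Continuous fun s : ℝ => ∑' j, f j s :=
    hdiff.continuous.comp Complex.continuous_ofReal
  refine ⟨fun z => ∑' j, f j z, hdiff, ?_, D * ∑' j : ℕ, 1 / ((j : ℝ) + 1) ^ 2,
    4 * (2 * q.natDegree + 2 + 2), fun s => ?_⟩
  · have hm := memLp_of_continuous (K := K) hcont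
    -- The L² sum and the locally uniform sum are identified weakly, by pairing with g and
    -- exchanging sum and integral.
    have : sqrtAbs A u = hm.toLp _ := by
      refine ext_inner_left ℂ fun g => ?_
      have h1 : HasSum (fun j => (inner ℂ g (A (h j)) : ℂ)) (inner ℂ g (sqrtAbs A u)) :=
        (innerSL ℂ g).hasSum hsum
      rw [inner_toLp, ← h1.tsum_eq]
      have h2 : ∀ j, (inner ℂ g (A (h j)) : ℂ) =
          ∫ s : ℝ in Ioo (0 : ℝ) K, (starRingEnd ℂ) (g s) * f j s := by
        intro j
        rw [inner_L2]
        refine integral_congr_ae ?_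
        filter_upwards [hfA j] with s hs
        rw [hs]
      simp_rw [h2]
      have hgi : Integrable (fun s => (starRingEnd ℂ) (g s)) (volume.restrict (Ioo (0 : ℝ) K)) :=
        Complex.conjCLE.toContinuousLinearMap.integrable_comp (integrable_L2 g)
      have hbound : ∀ j, ∀ᵐ s : ℝ ∂(volume.restrict (Ioo (0 : ℝ) K)),
          ‖f j s‖ ≤ B * (3 / 4) ^ j * Real.exp (B * (1 + K) ^ 4) := by
        intro j
        filter_upwards [ae_restrict_mem measurableSet_Ioo] with s hs
        refine hlocal K j s ?_
        rw [Complex.norm_real, Real.norm_of_nonneg hs.1.le]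
        exact hs.2.le
      have hint : ∀ j, Integrable (fun s : ℝ => (starRingEnd ℂ) (g s) * f j s)
          (volume.restrict (Ioo (0 : ℝ) K)) := fun j =>
        hgi.mul_bdd ((hfd j).continuous.comp Complex.continuous_ofReal).aestronglyMeasurable
          (hbound j)
      rw [integral_tsum_of_summable_integral_norm hint]
      · refine integral_congr_ae (Eventually.of_forall fun s => ?_)
        simp only
        rw [tsum_mul_left]
      · refine Summable.of_nonneg_of_le (fun j => integral_nonneg fun s => norm_nonneg _)
          (fun j => ?_) ((hgeo K).mul_left (∫ s in Ioo (0 : ℝ) K, ‖g s‖))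
        rw [← integral_mul_const]
        refine integral_mono_ae (hint j).norm ((integrable_L2 g).norm.mul_const _) ?_
        filter_upwards [hbound j] with s hs
        rw [norm_mul, RCLike.norm_conj]
        gcongr
    rw [this]
    exact hm.coeFn_toLp
  · have hS : Summable fun j : ℕ => 1 / ((j : ℝ) + 1) ^ 2 := by
      have := (summable_nat_add_iff 1).2 (Real.summable_one_div_nat_pow.2 (by norm_num : 1 < 2))
      simpa using this
    have h1 := tsum_of_norm_bounded (hS.hasSum.mul_left (D * (1 + |s|) ^ (4 * (2 * q.natDegree + 2 + 2)) *
      max (Real.exp (-(s * α))) (Real.exp (-(s * β))))) (fun j => haxis j s)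
    refine h1.trans (le_of_eq ?_)
    ring


/-! ### The far-field operator as an operator with an exponential-integral kernel -/

namespace Source

variable (P : Source)

lemma ae_nonneg_S : ∀ᵐ z ∂((volume.restrict P.D).prod (volume : Measure ℝ)), 0 ≤ P.S z.1 z.2 := by
  have hmeas : MeasurableSet {z : E3 × ℝ | 0 ≤ P.S z.1 z.2} :=
    measurableSet_le measurable_const P.measurable_S
  have h2 : ∀ᵐ z ∂((volume : Measure ℝ).prod (volume.restrict P.D)), 0 ≤ P.S z.2 z.1 := by
    have hmeas' : MeasurableSet {z : ℝ × E3 | 0 ≤ P.S z.2 z.1} := measurable_swap hmeas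
    rw [Measure.ae_prod_iff_ae_ae hmeas']
    refine Eventually.of_forall fun t => ?_
    obtain ⟨c₀, hc₀, h⟩ := P.pos_S
    by_cases ht : t ∈ Icc P.tmin P.tmax
    · filter_upwards [h t ht] with y hy using hc₀.le.trans hy
    · exact Eventually.of_forall fun y => (P.eq_zero_of_notMem y t fun h => ht h.2).ge
  exact (Measure.measurePreserving_swap (μ := volume.restrict P.D)
    (ν := (volume : Measure ℝ))).quasiMeasurePreserving.ae h2

instance : IsFiniteMeasure (volume.restrict P.D) :=
  ⟨by simpa using P.isBounded_D.measure_lt_top⟩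

lemma integrable_S : Integrable (fun z : E3 × ℝ => P.S z.1 z.2)
    ((volume.restrict P.D).prod (volume : Measure ℝ)) := by
  obtain ⟨C, -, hC⟩ := P.exists_bound
  have hmeas : MeasurableSet {z : E3 × ℝ |
      ‖P.S z.1 z.2‖ ≤ (Icc P.tmin P.tmax).indicator (fun _ => C) z.2} :=
    measurableSet_le P.measurable_S.norm
      ((measurable_const.indicator measurableSet_Icc).comp measurable_snd)
  have hae := (Measure.ae_prod_iff_ae_ae (μ := volume.restrict P.D) (ν := (volume : Measure ℝ))
    (p := fun z => ‖P.S z.1 z.2‖ ≤ (Icc P.tmin P.tmax).indicator (fun _ => C) z.2) hmeas).2 hC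
  refine Integrable.mono' ?_ P.measurable_S.aestronglyMeasurable hae
  simpa using (integrable_const (μ := volume.restrict P.D) (1 : ℝ)).mul_prod (P.integrable_ind C)

lemma bddAbove_inner (x : E3) : BddAbove ((fun z => (inner ℝ x z : ℝ)) '' P.D) := by
  obtain ⟨R, -, hR⟩ := P.isBounded_D.exists_pos_norm_le
  refine ⟨‖x‖ * R, ?_⟩
  rintro _ ⟨z, hz, rfl⟩
  exact (real_inner_le_norm x z).trans (by gcongr; exact hR z hz)

lemma bddBelow_inner (x : E3) : BddBelow ((fun z => (inner ℝ x z : ℝ)) '' P.D) := by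
  obtain ⟨R, -, hR⟩ := P.isBounded_D.exists_pos_norm_le
  refine ⟨-(‖x‖ * R), ?_⟩
  rintro _ ⟨z, hz, rfl⟩
  have h1 := neg_le_of_abs_le (abs_real_inner_le_norm x z)
  have h2 : ‖x‖ * ‖z‖ ≤ ‖x‖ * R := by gcongr; exact hR z hz
  simp only
  linarith

/-- The far-field pattern is the Fourier transform of a positive measure, the law of `t - x̂·y`
under the source density. -/
lemma exists_farField_eq (x : E3) : ∃ ν : Measure ℝ, IsFiniteMeasure ν ∧
    (∀ᵐ ξ ∂ν, ξ ∈ Icc (P.tmin - sSup ((fun z => (inner ℝ x z : ℝ)) '' P.D))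
      (P.tmax - sInf ((fun z => (inner ℝ x z : ℝ)) '' P.D))) ∧
    ∀ k : ℝ, P.farField x k = ∫ ξ : ℝ, Complex.exp (Complex.I * k * ξ) ∂ν := by
  set m := (volume.restrict P.D).prod (volume : Measure ℝ) with hm
  set c : ℝ := 1 / Real.sqrt (2 * Real.pi) with hc
  have hc0 : 0 ≤ c := by positivity
  set ρ : E3 × ℝ → ℝ≥0∞ := fun z => ENNReal.ofReal (c * P.S z.1 z.2) with hρ
  have hSm : Measurable fun z : E3 × ℝ => P.S z.1 z.2 := P.measurable_S
  have hρm : Measurable ρ := (hSm.const_mul c).ennreal_ofReal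
  set T : E3 × ℝ → ℝ := fun z => z.2 - inner ℝ x z.1 with hT
  have hTm : Measurable T := by fun_prop
  have hfin : IsFiniteMeasure (m.withDensity ρ) := by
    refine isFiniteMeasure_withDensity_ofReal ?_
    exact (P.integrable_S.const_mul c).2
  refine ⟨(m.withDensity ρ).map T, inferInstance, ?_, fun k => ?_⟩
  · refine (ae_map_iff hTm.aemeasurable measurableSet_Icc).2 ?_
    rw [ae_withDensity_iff hρm]
    refine Eventually.of_forall fun z hz => ?_
    have hz' : z.1 ∈ P.D ∧ z.2 ∈ Icc P.tmin P.tmax := by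
      by_contra hcon
      exact hz (by simp [hρ, P.eq_zero_of_notMem _ _ hcon])
    have h1 := le_csSup (P.bddAbove_inner x) (mem_image_of_mem _ hz'.1)
    have h2 := csInf_le (P.bddBelow_inner x) (mem_image_of_mem _ hz'.1)
    exact ⟨by simp only [hT]; linarith [hz'.2.1], by simp only [hT]; linarith [hz'.2.2]⟩
  · have hexp : ∀ z : E3 × ℝ, ‖Complex.exp (Complex.I * k * (T z : ℂ))‖ = 1 := fun z => by
      rw [norm_exp_I_mul]; simp
    have hexpm : Measurable fun z : E3 × ℝ => Complex.exp (Complex.I * k * (T z : ℂ)) := by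
      fun_prop
    rw [integral_map hTm.aemeasurable (Continuous.aestronglyMeasurable (by fun_prop)),
      integral_withDensity_eq_integral_toReal_smul hρm
        (Eventually.of_forall fun z => ENNReal.ofReal_lt_top)]
    -- `ENNReal.ofReal` would cut off negative values; the source is nonnegative a.e., so nothing is
    -- lost.
    have h1 : ∫ z, (ρ z).toReal • Complex.exp (Complex.I * k * (T z : ℂ)) ∂m =
        ∫ z, ((c * P.S z.1 z.2 : ℝ) : ℂ) * Complex.exp (Complex.I * k * (T z : ℂ)) ∂m := by
      refine integral_congr_ae ?_
      filter_upwards [P.ae_nonneg_S] with z hz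
      simp only [hρ]
      rw [ENNReal.toReal_ofReal (mul_nonneg hc0 hz), Complex.real_smul]
    have hint : Integrable (fun z : E3 × ℝ => ((c * P.S z.1 z.2 : ℝ) : ℂ) *
        Complex.exp (Complex.I * k * (T z : ℂ))) m :=
      (P.integrable_S.const_mul c).ofReal.mul_bdd (c := 1) hexpm.aestronglyMeasurable
        (Eventually.of_forall fun z => (hexp z).le)
    rw [h1, integral_prod _ hint]
    refine integral_congr_ae (Eventually.of_forall fun y => ?_)
    simp only [freqSource]
    rw [← mul_assoc, ← integral_const_mul]
    refine integral_congr_ae (Eventually.of_forall fun t => ?_)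
    have h2 : Complex.exp (Complex.I * k * (T (y, t) : ℂ)) =
        Complex.exp (-Complex.I * k * (inner ℝ x y : ℝ)) * Complex.exp (Complex.I * k * t) := by
      rw [← Complex.exp_add]; congr 1; simp only [hT]; push_cast; ring
    simp only
    rw [h2, ← hc]
    push_cast
    ring

/-- The kernel e^{i(k_c+τ-s)ξ} factors as e^{iτξ} e^{ik_cξ} e^{-isξ}, which after integration in s
and ξ is L c L^*. -/
lemma isExpOp_farFieldOp {kmin kmax : ℝ} {x : E3} {ν : Measure ℝ} [IsFiniteMeasure ν] {a : ℝ}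
    (hν : ∀ᵐ ξ ∂ν, |ξ| ≤ a)
    (hF : ∀ k : ℝ, P.farField x k = ∫ ξ : ℝ, Complex.exp (Complex.I * k * ξ) ∂ν) :
    IsExpOp ν (fun ξ => Complex.exp (Complex.I * ((kmin + kmax) / 2 : ℝ) * ξ))
      (farFieldOp P kmin kmax x) := by
  set K := (kmax - kmin) / 2 with hK
  set kc : ℝ := (kmin + kmax) / 2 with hkc
  refine isExpOp_of_coeFn hν (by fun_prop) fun h => ?_
  have hcont : Continuous fun u : ℝ => P.farField x (kc + u) :=
    (P.continuous_farField x).comp (continuous_const.add continuous_id)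
  have h1 : farFieldOp P kmin kmax x h =ᵐ[volume.restrict (Ioo (0 : ℝ) K)]
      fun τ => ∫ s in Ioo (0 : ℝ) K, P.farField x (kc + (τ - s)) * h s :=
    (memLp_conv hcont K h).coeFn_toLp
  refine h1.trans (Eventually.of_forall fun τ => ?_)
  simp only
  have hi : Integrable (Function.uncurry fun s ξ : ℝ =>
      Complex.exp (Complex.I * ((kc + (τ - s) : ℝ) : ℂ) * ξ) * (h s * 1))
      ((volume.restrict (Ioo (0 : ℝ) K)).prod ν) := by
    refine ((integrable_L2 h).mul_prod (integrable_const (μ := ν) (1 : ℂ))).bdd_mul (c := 1)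
      (f := fun z : ℝ × ℝ => Complex.exp (Complex.I * ((kc + (τ - z.1) : ℝ) : ℂ) * z.2))
      (by fun_prop) (Eventually.of_forall fun z => ?_)
    rw [norm_exp_I_mul, Complex.ofReal_im]
    simp
  calc ∫ s in Ioo (0 : ℝ) K, P.farField x (kc + (τ - s)) * h s
      = ∫ s in Ioo (0 : ℝ) K, ∫ ξ : ℝ,
          Complex.exp (Complex.I * ((kc + (τ - s) : ℝ) : ℂ) * ξ) * (h s * 1) ∂ν := by
        refine integral_congr_ae (Eventually.of_forall fun s => ?_)
        simp only
        rw [hF, integral_mul_const, mul_one]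
    _ = ∫ ξ : ℝ, (∫ s in Ioo (0 : ℝ) K,
          Complex.exp (Complex.I * ((kc + (τ - s) : ℝ) : ℂ) * ξ) * (h s * 1)) ∂ν :=
        integral_integral_swap hi
    _ = _ := by
        refine integral_congr_ae (Eventually.of_forall fun ξ => ?_)
        simp only [finFourier]
        rw [← mul_assoc, ← integral_const_mul]
        refine integral_congr_ae (Eventually.of_forall fun s => ?_)
        simp only
        rw [mul_one, ← mul_assoc, ← Complex.exp_add, ← Complex.exp_add]
        congr 2
        push_cast
        ring

end Source

/-! ### The test functions -/

/-- The entire extension of the test function `testFun a b x y`. -/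
def testExt (a b p : ℝ) (z : ℂ) : ℂ :=
  ((1 / (b - a) : ℝ) : ℂ) * expInt (volume.restrict (Ioc a b)) (fun _ => 1) z *
    Complex.exp (-Complex.I * z * p)

lemma differentiable_testExt (a b p : ℝ) : Differentiable ℂ (testExt a b p) := by
  have hν : ∀ᵐ ξ ∂(volume.restrict (Ioc a b)), |ξ| ≤ max |a| |b| := by
    filter_upwards [ae_restrict_mem measurableSet_Ioc] with ξ hξ
      using abs_le_max_abs_abs hξ.1.le hξ.2
  have h := differentiable_expInt hν (integrable_const (1 : ℂ))
  unfold testExt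
  fun_prop

lemma testFun_eq_testExt {a b : ℝ} (hab : a ≤ b) (x y : E3) (k : ℝ) :
    testFun a b x y k = testExt a b (inner ℝ x y) k := by
  simp only [testFun, testExt, expInt, mul_one]
  rw [intervalIntegral.integral_of_le hab]

/-- At z = is the integrand e^{-s(t-p)} is positive, so nothing cancels and any subwindow [t₁,t₂]
bounds the whole from below. -/
lemma le_norm_testExt {a b p s t₁ t₂ m : ℝ} (hab : a < b) (h1 : a ≤ t₁) (h12 : t₁ < t₂)
    (h2 : t₂ ≤ b) (hm : ∀ t ∈ Icc t₁ t₂, m ≤ Real.exp (-(s * (t - p)))) :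
    (t₂ - t₁) / (b - a) * m ≤ ‖testExt a b p (Complex.I * s)‖ := by
  have e1 : expInt (volume.restrict (Ioc a b)) (fun _ => 1) (Complex.I * s) =
      ((∫ t in Ioc a b, Real.exp (-(s * t)) : ℝ) : ℂ) := by
    rw [expInt, ← integral_complex_ofReal]
    refine integral_congr_ae (Eventually.of_forall fun t => ?_)
    simp only
    rw [mul_one, ← mul_assoc, Complex.I_mul_I]
    push_cast
    congr 1
    ring
  have e2 : Complex.exp (-Complex.I * (Complex.I * s) * p) = ((Real.exp (s * p) : ℝ) : ℂ) := by
    push_cast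
    congr 1
    linear_combination (-(s : ℂ) * p) * Complex.I_mul_I
  have e3 : ‖testExt a b p (Complex.I * s)‖ =
      1 / (b - a) * ∫ t in Ioc a b, Real.exp (-(s * (t - p))) := by
    rw [testExt, e1, e2, ← Complex.ofReal_mul, ← Complex.ofReal_mul, Complex.norm_real,
      Real.norm_of_nonneg, mul_assoc, ← integral_mul_const]
    · congr 1
      refine integral_congr_ae (Eventually.of_forall fun t => ?_)
      simp only
      rw [← Real.exp_add]
      congr 1
      ring
    · have : 0 < b - a := by linarith
      have : 0 ≤ ∫ t in Ioc a b, Real.exp (-(s * t)) := integral_nonneg fun t => (Real.exp_pos _).le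
      positivity
  have hci : ∀ c d : ℝ, IntegrableOn (fun t => Real.exp (-(s * (t - p)))) (Ioc c d) := fun c d =>
    (Continuous.integrableOn_Icc (by fun_prop)).mono_set Ioc_subset_Icc_self
  have e4 : (t₂ - t₁) * m ≤ ∫ t in Ioc a b, Real.exp (-(s * (t - p))) := by
    calc (t₂ - t₁) * m = ∫ _ in Ioc t₁ t₂, m := by
          rw [setIntegral_const, Real.volume_real_Ioc_of_le h12.le, smul_eq_mul]
      _ ≤ ∫ t in Ioc t₁ t₂, Real.exp (-(s * (t - p))) := by
          refine setIntegral_mono_on (integrableOn_const (by simp)) (hci _ _) measurableSet_Ioc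
            fun t ht => hm t (Ioc_subset_Icc_self ht)
      _ ≤ _ := setIntegral_mono_set (hci _ _) (Eventually.of_forall fun t => (Real.exp_pos _).le)
          (Ioc_subset_Ioc h1 h2).eventuallyLE
  rw [e3, div_mul_eq_mul_div, one_div_mul_eq_div]
  have : 0 < b - a := by linarith
  gcongr

/-- The test function is continuous with value 1 at k = 0, an endpoint of (0,K), hence the passage
to the closure. -/
lemma testVec_ne_zero {a b : ℝ} (hab : a < b) (x y : E3) {K : ℝ} (hK : 0 < K) :
    testVec a b x y K ≠ 0 := by
  intro h0
  have h1 : testFun a b x y =ᵐ[volume.restrict (Ioo (0 : ℝ) K)] fun _ => 0 := by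
    refine (memLp_testFun a b x y K).coeFn_toLp.symm.trans ?_
    change (testVec a b x y K : ℝ → ℂ) =ᵐ[_] _
    rw [h0]
    exact Lp.coeFn_zero _ _ _
  have hc : Continuous (testFun a b x y) := by
    have : testFun a b x y = fun k : ℝ => testExt a b (inner ℝ x y) k :=
      funext fun k => testFun_eq_testExt hab.le x y k
    rw [this]
    exact (differentiable_testExt a b _).continuous.comp Complex.continuous_ofReal
  have h2 := Measure.eqOn_open_of_ae_eq h1 isOpen_Ioo hc.continuousOn continuousOn_const
  have h3 := h2.closure hc continuous_const
  rw [closure_Ioo hK.ne] at h3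
  have h4 := h3 (left_mem_Icc.2 hK.le)
  have h5 : ((b : ℂ) - a) ≠ 0 := by
    have : b - a ≠ 0 := by linarith
    exact_mod_cast this
  simp [testFun, h5] at h4

lemma picardSum_ne_zero {H : Type*} [NormedAddCommGroup H] [InnerProductSpace ℂ H]
    [CompleteSpace H] {T : H →L[ℂ] H} {lam : ℕ → ℝ} {ψ : ℕ → H} (hψ : IsEigensystem T lam ψ)
    {φ : H} (hφ : φ ≠ 0) : picardSum lam ψ φ ≠ 0 := by
  intro h0
  refine hφ ?_
  have h1 : ∀ n, (inner ℂ (ψ n) φ : ℂ) = 0 := by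
    intro n
    have h2 := ENNReal.tsum_eq_zero.1 h0 n
    rw [ENNReal.div_eq_zero_iff] at h2
    rcases h2 with h2 | h2
    · rw [ENNReal.ofReal_eq_zero] at h2
      have : ‖(inner ℂ (ψ n) φ : ℂ)‖ = 0 := by
        nlinarith [norm_nonneg (inner ℂ (ψ n) φ : ℂ)]
      exact norm_eq_zero.1 this
    · exact absurd h2 ENNReal.ofReal_ne_top
  have hb := (HilbertBasis.mk hψ.orthonormal hψ.complete.ge).hasSum_repr φ
  refine hb.unique ?_
  convert hasSum_zero using 2 with n
  rw [HilbertBasis.repr_apply_apply, HilbertBasis.coe_mk, h1, zero_smul]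

/-! ### Divergence of the Picard series -/

lemma not_forall_exp_le {c δ D₁ D₂ : ℝ} (hc : 0 < c) (hδ : 0 < δ) (P₁ P₂ : ℕ) :
    ¬ ∀ s : ℝ, 0 ≤ s → c * Real.exp (δ * s) ≤ D₁ * (1 + s) ^ P₁ + D₂ * (1 + s) ^ P₂ := by
  intro h
  have ho : (fun v : ℝ => D₁ * v ^ P₁ + D₂ * v ^ P₂) =o[atTop] fun v => Real.exp (δ * v) :=
    ((isLittleO_pow_exp_pos_mul_atTop P₁ hδ).const_mul_left D₁).add
      ((isLittleO_pow_exp_pos_mul_atTop P₂ hδ).const_mul_left D₂)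
  have hpos : 0 < c * Real.exp (-δ) / 2 := by positivity
  obtain ⟨v, hv, hv1⟩ := ((ho.bound hpos).and (eventually_ge_atTop 1)).exists
  have h1 := h (v - 1) (by linarith)
  rw [add_sub_cancel] at h1
  rw [Real.norm_of_nonneg (Real.exp_pos _).le] at hv
  have h2 := (Real.le_norm_self _).trans hv
  have h3 : Real.exp (δ * (v - 1)) = Real.exp (-δ) * Real.exp (δ * v) := by
    rw [← Real.exp_add]; congr 1; ring
  rw [h3] at h1
  have h4 : 0 < c * Real.exp (-δ) * Real.exp (δ * v) := by positivity
  nlinarith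

lemma eq_of_ae_eq_Ioo {f g : ℂ → ℂ} (hf : Differentiable ℂ f) (hg : Differentiable ℂ g) {K : ℝ}
    (hK : 0 < K) (h : (fun s : ℝ => f s) =ᵐ[volume.restrict (Ioo (0 : ℝ) K)] fun s : ℝ => g s) :
    f = g := by
  have h1 := Measure.eqOn_open_of_ae_eq h isOpen_Ioo
    (hf.continuous.comp Complex.continuous_ofReal).continuousOn
    (hg.continuous.comp Complex.continuous_ofReal).continuousOn
  have h2 : ∀ᶠ s : ℝ in 𝓝[≠] (K / 2), f s = g s := by
    refine eventually_nhdsWithin_of_eventually_nhds ?_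
    filter_upwards [Ioo_mem_nhds (by linarith : 0 < K / 2) (by linarith : K / 2 < K)] with s hs
      using h1 hs
  have h3 : Tendsto (fun s : ℝ => (s : ℂ)) (𝓝[≠] (K / 2)) (𝓝[≠] ((K / 2 : ℝ) : ℂ)) :=
    tendsto_nhdsWithin_of_tendsto_nhds_of_eventually_within _
      ((Complex.continuous_ofReal.tendsto _).mono_left nhdsWithin_le_nhds)
      (by
        filter_upwards [self_mem_nhdsWithin] with s hs using
          fun h => hs (Complex.ofReal_injective h))
  exact AnalyticOnNhd.eq_of_frequently_eq (fun z _ => hf.analyticAt z) (fun z _ => hg.analyticAt z)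
    (h3.frequently h2.frequently)

/-- The hypothesis says a - p < α or b - p > β: the exponents t - p of the test function leave
[α,β], and its entire extension outgrows every element of the two ranges on one half of the
imaginary axis. -/
lemma picardSum_eq_top (P : Source) {kmin kmax : ℝ} (hk : kmin < kmax) {x : E3}
    {lam : ℕ → ℝ} {ψ : ℕ → L2 ((kmax - kmin) / 2)}
    (hψ : IsEigensystem (sharp (farFieldOp P kmin kmax x)) lam ψ) {a b : ℝ} (hab : a < b) {y : E3}
    (hout : sSup ((fun z => (inner ℝ x z : ℝ)) '' P.D) - P.tmin < inner ℝ x y - a ∨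
      inner ℝ x y - b < sInf ((fun z => (inner ℝ x z : ℝ)) '' P.D) - P.tmax) :
    picardSum lam ψ (testVec a b x y ((kmax - kmin) / 2)) = ∞ := by
  have hK : 0 < (kmax - kmin) / 2 := by linarith
  obtain ⟨ν, hfin, hν, hF⟩ := P.exists_farField_eq x
  set α := P.tmin - sSup ((fun z => (inner ℝ x z : ℝ)) '' P.D) with hα
  set β := P.tmax - sInf ((fun z => (inner ℝ x z : ℝ)) '' P.D) with hβ
  have hαβ : α ≤ β := by
    obtain ⟨z, hz⟩ := P.isConnected_D.nonempty
    have h1 := (csInf_le (P.bddBelow_inner x) (mem_image_of_mem _ hz)).trans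
      (le_csSup (P.bddAbove_inner x) (mem_image_of_mem _ hz))
    linarith [P.tmin_lt_tmax]
  have hνa : ∀ᵐ ξ ∂ν, |ξ| ≤ max |α| |β| := by
    filter_upwards [hν] with ξ hξ using abs_le_max_abs_abs hξ.1 hξ.2
  have hFop := P.isExpOp_farFieldOp (kmin := kmin) (kmax := kmax) hνa hF
  set F := farFieldOp P kmin kmax x with hFdef
  set p : ℝ := inner ℝ x y with hp
  set A₁ := (realPart F : L2 ((kmax - kmin) / 2) →L[ℂ] L2 ((kmax - kmin) / 2)) with hA₁
  set A₂ := (imaginaryPart F : L2 ((kmax - kmin) / 2) →L[ℂ] L2 ((kmax - kmin) / 2)) with hA₂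
  have hs₁ : IsSelfAdjoint A₁ := (realPart F).2
  have hs₂ : IsSelfAdjoint A₂ := (imaginaryPart F).2
  by_contra hne
  obtain ⟨u, v, huv⟩ := exists_eq_add_of_picardSum_ne_top (isSelfAdjoint_sqrtAbs A₁)
    (isSelfAdjoint_sqrtAbs A₂) (T := sharp F)
    (by rw [sqrtAbs_mul_self hs₁, sqrtAbs_mul_self hs₂]; rfl) hψ hne
  have hop₁ : IsExpOp ν (fun ξ => ((Real.sin ((kmin + kmax) / 2 * ξ + Real.pi / 2) : ℝ) : ℂ)) A₁ := by
    simp_rw [Real.sin_add_pi_div_two]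
    exact isExpOp_realPart hνa hFop
  have hop₂ : IsExpOp ν (fun ξ => ((Real.sin ((kmin + kmax) / 2 * ξ + 0) : ℝ) : ℂ)) A₂ := by
    simp_rw [add_zero]
    exact isExpOp_imaginaryPart hνa hFop
  obtain ⟨f₁, hf₁, hae₁, D₁, P₁, hb₁⟩ := exists_entire_extension hK hν hs₁ hop₁ u
  obtain ⟨f₂, hf₂, hae₂, D₂, P₂, hb₂⟩ := exists_entire_extension hK hν hs₂ hop₂ v
  have heq : testExt a b p = fun z => f₁ z + f₂ z := by
    refine eq_of_ae_eq_Ioo (differentiable_testExt a b p) (hf₁.add hf₂) hK ?_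
    have h1 : testVec a b x y ((kmax - kmin) / 2) =ᵐ[volume.restrict (Ioo (0 : ℝ) _)]
        testFun a b x y := (memLp_testFun a b x y _).coeFn_toLp
    rw [huv] at h1
    filter_upwards [h1, hae₁, hae₂, Lp.coeFn_add (sqrtAbs A₁ u) (sqrtAbs A₂ v)] with s e1 e2 e3 e4
    rw [← testFun_eq_testExt hab.le, ← e1, e4, Pi.add_apply, e2, e3]
  have hup : ∀ s : ℝ, ‖testExt a b p (Complex.I * s)‖ ≤
      (D₁ * (1 + |s|) ^ P₁ + D₂ * (1 + |s|) ^ P₂) *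
        max (Real.exp (-(s * α))) (Real.exp (-(s * β))) := by
    intro s
    rw [heq, add_mul]
    exact (norm_add_le _ _).trans (add_le_add (hb₁ s) (hb₂ s))
  have hba : 0 < b - a := by linarith
  rcases hout with h | h
  -- The midpoint of a - p and α. The times with t - p ≤ γ have positive measure and contribute a
  -- multiple of e^{-sγ}, exponentially larger than e^{-sα} as s → +∞.
  · set γ : ℝ := (a - p + α) / 2 with hγ
    have hγα : γ < α := by linarith
    have ht : a < min b (γ + p) := lt_min hab (by linarith)
    refine not_forall_exp_le (c := (min b (γ + p) - a) / (b - a)) (δ := α - γ) (D₁ := D₁) (D₂ := D₂)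
      (div_pos (by linarith) hba) (by linarith) P₁ P₂ fun s hs => ?_
    have h1 := (le_norm_testExt (p := p) (s := s) (m := Real.exp (-(s * γ))) hab le_rfl ht
      (min_le_left _ _) fun t ht' => Real.exp_le_exp.2 (by
        have : t - p ≤ γ := by linarith [ht'.2, min_le_right b (γ + p)]
        nlinarith)).trans (hup s)
    rw [max_eq_left (Real.exp_le_exp.2 (by nlinarith)), abs_of_nonneg hs] at h1
    have h2 : Real.exp (-(s * γ)) = Real.exp ((α - γ) * s) * Real.exp (-(s * α)) := by
      rw [← Real.exp_add]; congr 1; ring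
    rw [h2, ← mul_assoc] at h1
    exact le_of_mul_le_mul_right h1 (Real.exp_pos _)
  -- The mirror case, at the other end of the window and with s → -∞.
  · set γ : ℝ := (b - p + β) / 2 with hγ
    have hγβ : β < γ := by linarith
    have ht : max a (γ + p) < b := max_lt hab (by linarith)
    refine not_forall_exp_le (c := (b - max a (γ + p)) / (b - a)) (δ := γ - β) (D₁ := D₁) (D₂ := D₂)
      (div_pos (by linarith) hba) (by linarith) P₁ P₂ fun s hs => ?_
    have h1 := (le_norm_testExt (p := p) (s := -s) (m := Real.exp (s * γ)) hab (le_max_left _ _) ht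
      le_rfl fun t ht' => Real.exp_le_exp.2 (by
        have : γ ≤ t - p := by linarith [ht'.1, le_max_right a (γ + p)]
        nlinarith)).trans (hup (-s))
    rw [max_eq_right (Real.exp_le_exp.2 (by nlinarith)), abs_neg, abs_of_nonneg hs] at h1
    have h2 : Real.exp (s * γ) = Real.exp ((γ - β) * s) * Real.exp (-(-s * β)) := by
      rw [← Real.exp_add]; congr 1; ring
    rw [h2, ← mul_assoc] at h1
    exact le_of_mul_le_mul_right h1 (Real.exp_pos _)

/-! ### Strips and the `Θ`-convex hull -/

lemma inner_neg_image (D : Set E3) (x : E3) :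
    (fun z => (inner ℝ (-x) z : ℝ)) '' D = -((fun z => (inner ℝ x z : ℝ)) '' D) := by
  rw [← image_neg_eq_neg, image_image]
  simp_rw [inner_neg_left]

lemma sSup_inner_neg (D : Set E3) (x : E3) :
    sSup ((fun z => (inner ℝ (-x) z : ℝ)) '' D) = -sInf ((fun z => (inner ℝ x z : ℝ)) '' D) := by
  rw [inner_neg_image, Real.sSup_neg]

lemma sInf_inner_neg (D : Set E3) (x : E3) :
    sInf ((fun z => (inner ℝ (-x) z : ℝ)) '' D) = -sSup ((fun z => (inner ℝ x z : ℝ)) '' D) := by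
  rw [inner_neg_image, Real.sInf_neg]

namespace Source

variable (P : Source)

lemma inner_mem_Ioo {x z : E3} (hx : ‖x‖ = 1) (hz : z ∈ P.D) :
    sInf ((fun z => (inner ℝ x z : ℝ)) '' P.D) < inner ℝ x z ∧
      inner ℝ x z < sSup ((fun z => (inner ℝ x z : ℝ)) '' P.D) := by
  obtain ⟨ε, hε, hball⟩ := Metric.isOpen_iff.1 P.isOpen_D z hz
  have hmem : ∀ r : ℝ, |r| = ε / 2 → z + r • x ∈ P.D := fun r hr => hball (by
    rw [mem_ball_iff_norm, add_sub_cancel_left, norm_smul, hx, Real.norm_eq_abs, hr]; linarith)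
  have hin : ∀ r : ℝ, (inner ℝ x (z + r • x) : ℝ) = inner ℝ x z + r := fun r => by
    rw [inner_add_right, real_inner_smul_right, real_inner_self_eq_norm_sq, hx]; ring
  have h1 := le_csSup (P.bddAbove_inner x)
    (mem_image_of_mem (fun z => (inner ℝ x z : ℝ)) (hmem (ε / 2) (abs_of_pos (by linarith))))
  have h2 := csInf_le (P.bddBelow_inner x)
    (mem_image_of_mem (fun z => (inner ℝ x z : ℝ))
      (hmem (-(ε / 2)) (by rw [abs_neg]; exact abs_of_pos (by linarith))))
  simp only [hin] at h1 h2
  constructor <;> linarith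

/-- If all the non-strict inequalities held at y, moving y slightly towards a point of D, where they
are strict, would enter the hull, so y would be in its closure. -/
lemma exists_of_notMem_closure_thetaHull {M : ℕ} {x : Fin M → E3} (hx : ∀ j, ‖x j‖ = 1) {y : E3}
    (hy : y ∉ closure (thetaHull P.D x)) : ∃ j,
      inner ℝ (x j) y < sInf ((fun z => (inner ℝ (x j) z : ℝ)) '' P.D) ∨
      sSup ((fun z => (inner ℝ (x j) z : ℝ)) '' P.D) < inner ℝ (x j) y := by
  by_contra! hcon
  refine hy ?_
  obtain ⟨z, hz⟩ := P.isConnected_D.nonempty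
  have ht : Tendsto (fun s : ℝ => y + s • (z - y)) (𝓝[>] 0) (𝓝 y) := by
    have hc : Continuous fun s : ℝ => y + s • (z - y) := by fun_prop
    have := hc.tendsto 0
    simp only [zero_smul, add_zero] at this
    exact this.mono_left nhdsWithin_le_nhds
  refine mem_closure_of_tendsto ht ?_
  filter_upwards [Ioo_mem_nhdsGT (zero_lt_one' ℝ)] with s hs
  refine mem_iInter.2 fun j => ?_
  have h1 := P.inner_mem_Ioo (hx j) hz
  have h2 := hcon j
  have h3 : (inner ℝ (x j) (y + s • (z - y)) : ℝ) =
      (1 - s) * inner ℝ (x j) y + s * inner ℝ (x j) z := by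
    rw [inner_add_right, real_inner_smul_right, inner_sub_right]; ring
  have h4 : 0 < 1 - s := by linarith [hs.2]
  have e1 := mul_le_mul_of_nonneg_left h2.1 h4.le
  have e2 := mul_le_mul_of_nonneg_left h2.2 h4.le
  have e3 := mul_lt_mul_of_pos_left h1.1 hs.1
  have e4 := mul_lt_mul_of_pos_left h1.2 hs.1
  refine ⟨?_, ?_⟩ <;> rw [h3] <;> linarith

end Source

/-! ### From the Picard sums to the indicator `W`. -/

lemma indicatorW_eq_zero {K : ℝ} {M : ℕ} {lam : E3 → ℕ → ℝ} {ψ : E3 → ℕ → L2 K} {a b : ℝ}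
    {x : Fin M → E3} {y : E3} (j : Fin M)
    (h : picardSum (lam (x j)) (ψ (x j)) (testVec a b (x j) y K) = ∞ ∨
      picardSum (lam (-x j)) (ψ (-x j)) (testVec a b (-x j) y K) = ∞) :
    indicatorW lam ψ a b x y = 0 := by
  rw [indicatorW, ENNReal.inv_eq_zero, ENNReal.sum_eq_top]
  refine ⟨j, Finset.mem_univ j, ?_⟩
  rw [indicatorPair, one_div, inv_inv, ENNReal.add_eq_top]
  exact h

lemma indicatorW_lt_top {K : ℝ} {M : ℕ} {lam : E3 → ℕ → ℝ} {ψ : E3 → ℕ → L2 K} {a b : ℝ}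
    {x : Fin M → E3} {y : E3} (j : Fin M)
    (h : picardSum (lam (x j)) (ψ (x j)) (testVec a b (x j) y K) ≠ 0) :
    indicatorW lam ψ a b x y < ∞ := by
  rw [indicatorW, ENNReal.inv_lt_top, pos_iff_ne_zero]
  intro h0
  have h1 := (Finset.sum_eq_zero_iff.1 h0) j (Finset.mem_univ j)
  rw [indicatorPair, one_div, inv_inv, add_eq_zero] at h1
  exact h h1.1

end MultiFreq

end

theorem theorem3p8 (P : MultiFreq.Source) (kmin kmax : ℝ) (hk0 : 0 ≤ kmin) (hk : kmin < kmax)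
    (M : ℕ) (hM : 0 < M) (x : Fin M → MultiFreq.E3) (hx : ∀ j, ‖x j‖ = 1)
    (lam : MultiFreq.E3 → ℕ → ℝ) (ψ : MultiFreq.E3 → ℕ → MultiFreq.L2 ((kmax - kmin) / 2))
    (hψ : ∀ j,
      MultiFreq.IsEigensystem (MultiFreq.sharp (MultiFreq.farFieldOp P kmin kmax (x j)))
        (lam (x j)) (ψ (x j)) ∧
      MultiFreq.IsEigensystem (MultiFreq.sharp (MultiFreq.farFieldOp P kmin kmax (-x j)))
        (lam (-x j)) (ψ (-x j))) :
    -- known initial moment: the test functions live on the window `[tmin, η]`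
    (∀ η ∈ Set.Ioc P.tmin P.tmax, ∀ y : MultiFreq.E3,
      (y ∈ MultiFreq.thetaHull P.D x →
        0 ≤ MultiFreq.indicatorW lam ψ P.tmin η x y ∧
          MultiFreq.indicatorW lam ψ P.tmin η x y < ⊤) ∧
      (y ∉ closure (MultiFreq.thetaHull P.D x) →
        MultiFreq.indicatorW lam ψ P.tmin η x y = 0)) ∧
    -- known terminal moment: the test functions live on the window `[η, tmax]`
    (∀ η ∈ Set.Ico P.tmin P.tmax, ∀ y : MultiFreq.E3,
      (y ∈ MultiFreq.thetaHull P.D x →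
        0 ≤ MultiFreq.indicatorW lam ψ η P.tmax x y ∧
          MultiFreq.indicatorW lam ψ η P.tmax x y < ⊤) ∧
      (y ∉ closure (MultiFreq.thetaHull P.D x) →
        MultiFreq.indicatorW lam ψ η P.tmax x y = 0)) := by
  have hK : 0 < (kmax - kmin) / 2 := by linarith
  have hfin : ∀ {a b : ℝ}, a < b → ∀ y, MultiFreq.indicatorW lam ψ a b x y < ⊤ :=
    fun hab y => MultiFreq.indicatorW_lt_top ⟨0, hM⟩ (MultiFreq.picardSum_ne_zero (hψ _).1
      (MultiFreq.testVec_ne_zero hab _ y hK))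
  refine ⟨fun η hη y => ⟨fun _ => ⟨zero_le, hfin hη.1 y⟩, fun hy => ?_⟩,
    fun η hη y => ⟨fun _ => ⟨zero_le, hfin hη.2 y⟩, fun hy => ?_⟩⟩
  · obtain ⟨j, hj⟩ := P.exists_of_notMem_closure_thetaHull hx hy
    refine MultiFreq.indicatorW_eq_zero j ?_
    -- With a = tmin the test detects only x̂·y > sup x̂·D; a point below the strip of x̂ lies above
    -- that of -x̂.
    rcases hj with h | h
    · refine Or.inr (MultiFreq.picardSum_eq_top P hk (hψ j).2 hη.1 (Or.inl ?_))
      rw [MultiFreq.sSup_inner_neg, inner_neg_left]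
      linarith
    · exact Or.inl (MultiFreq.picardSum_eq_top P hk (hψ j).1 hη.1 (Or.inl (by linarith)))
  · obtain ⟨j, hj⟩ := P.exists_of_notMem_closure_thetaHull hx hy
    refine MultiFreq.indicatorW_eq_zero j ?_
    -- With b = tmax the roles are exchanged: the test detects x̂·y < inf x̂·D, and -x̂ covers
    -- points above the strip.
    rcases hj with h | h
    · exact Or.inl (MultiFreq.picardSum_eq_top P hk (hψ j).1 hη.2 (Or.inr (by linarith)))
    · refine Or.inr (MultiFreq.picardSum_eq_top P hk (hψ j).2 hη.2 (Or.inr ?_))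
      rw [MultiFreq.sInf_inner_neg, inner_neg_left]
      linarith
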